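/- **Setting.** Time is slotted, $t=0,1,2,\dots$. Features are sent one at a time over a channel. The $i$-th feature ($i\ge 0$) is submitted in slot $S_i$ and delivered in slot $D_i=S_i+T_i$. The transmission times $T_i\in\{1,2,\dots\}$ are i.i.d. with $\mathbb E[T_i]<\infty$. At time $S_i$ the $(b_i+1)$-th freshest feature of a buffer of size $B\ge 1$ is sent, $b_i\in\{0,\dots,B-1\}$. Initially $S_0=0$, and $b_0$ and $\Delta(0)$ are given constants. A causal policy consists of $f=(b_1,b_2,\dots)$ and $g=(S_1,S_2,\dots)$ with $S_{i+1}\ge D_i$ ($S_{i+1}=\infty$ is allowed and means that nothing more is sent), where $(S_{i+1},b_{i+1})$ is a function of $T_0,\dots,T_i$ (and possibly of a fixed random element $\xi$ independent of $(T_j)_j$). The age of information is $\Delta(t)=t-S_i+b_i$ for $D_i\le t<D_{i+1}$, and $\Delta(t)=\Delta(0)+t$ for $t<D_0$. Let $p:\{0,1,2,\dots\}\to\mathbb R$ satisfy $|p(\delta)|\le M$ for all $\delta$, and let $$\bar p_{opt}=\inf_{(f,g)}\ \limsup_{n\to\infty}\frac1n\,\mathbb E\Big[\sum_{t=0}^{n-1}p(\Delta(t))\Big]$$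 be the infimum over all causal policies. Let $\bar p_b$ be the infimum over those with $b_i=b$ for all $i\ge1$. Put $$\gamma(\delta)=\inf_{\tau\in\{1,2,\dots\}}\frac1\tau\sum_{k=0}^{\tau-1}\mathbb E[p(\delta+k+T_1)].$$ For $b\in\{0,\dots,B-1\}$ and $\beta\in\mathbb R$ define $S_0(\beta)=0$, $D_i(\beta)=S_i(\beta)+T_i$ and $$S_{i+1}(\beta)=\min\{t\ge D_i(\beta):\gamma(t-S_i(\beta)+b)\ge\beta\}.$$ Call $\beta$ a *root for $b$* if these minima exist almost surely, the mean cycle length $\mathbb E[D_{i+1}(\beta)-D_i(\beta)]$ is finite, and, for every $i$, $$\mathbb E\Big[\sum_{t=D_i(\beta)}^{D_{i+1}(\beta)-1}p\big(t-S_i(\beta)+b\big)\Big]-\beta\,\mathbb E\big[D_{i+1}(\beta)-D_i(\beta)\big]=0 .\qquad(*)$$ **Theorem.** 1. For each $b$ there is at most one root. There is one whenever $\bar p_b<\liminf_{n\to\infty}\frac1n\sum_{\delta=0}^{n-1}p(\delta)$ (the case in which sending features is strictly better than sending nothing any more). 2. Suppose that for every $b\in\{0,\dots,B-1\}$ equation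 $(*)$ has a root, and let $\beta_b$ denote it. Then $$\bar p_{opt}=\min_{b\in\{0,\dots,B-1\}}\beta_b ,$$ and for every $b^*\in\arg\min_b\beta_b$ there is a causal policy $(f^*,g^*)$ that attains $\bar p_{opt}$, such that $f^*=(b^*,b^*,\dots)$ and $g^*=(S_1^*,S_2^*,\dots)$ with $$S_{i+1}^*=\min\{t\ge S_i^*+T_i:\ \gamma(\Delta(t))\ge\bar p_{opt}\},\qquad i=0,1,2,\dots,$$ where these minima exist almost surely. -/

import Mathlib

open MeasureTheory ProbabilityTheory Filter

noncomputable section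

namespace FeatureBuffer

variable {Ω : Type*} {Ξ : Type*}

/-- Delivery times `D i = S i + T i` (the value `⊤` means "never"). -/
def delivery (S : ℕ → Ω → ℕ∞) (T : ℕ → Ω → ℕ) (i : ℕ) (ω : Ω) : ℕ∞ :=
  S i ω + (T i ω : ℕ∞)

/-- The information the transmitter has from the delivery of feature `i` until the next delivery:
the observed transmission times `T 0, …, T i` and the outcome of the (optional) randomization
device `ξ`.  While the channel is idle nothing new is observed. -/
@[reducible] def history [MeasurableSpace Ξ] (ξ : Ω → Ξ) (T : ℕ → Ω → ℕ) (i : ℕ) : MeasurableSpace Ω :=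
  MeasurableSpace.comap ξ inferInstance ⊔
    ⨆ j : ℕ, ⨆ _ : j ≤ i, MeasurableSpace.comap (T j) ⊤

/-- A causal scheduling policy: random submission times `S 1, S 2, …` and buffer positions
`b 1, b 2, …` (feature `i` is the `(b i + 1)`-th freshest one in a buffer of size `B`).  A feature is
submitted only when the previous one has been delivered, and each decision is a function of the
information available when it is made.  `S i ω = ⊤` means that feature `i` is never
submitted.  Feature `0` is submitted in slot `0`, from buffer position `b₀`. -/
structure CausalPolicy [MeasurableSpace Ξ] (ξ : Ω → Ξ) (T : ℕ → Ω → ℕ) (B : ℕ) (b₀ : Fin B) where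
  S : ℕ → Ω → ℕ∞
  b : ℕ → Ω → Fin B
  S_zero : ∀ ω, S 0 ω = 0
  b_zero : ∀ ω, b 0 ω = b₀
  delivery_le : ∀ i ω, delivery S T i ω ≤ S (i + 1) ω
  causal_S : ∀ i, Measurable[history ξ T i, ⊤] (S (i + 1))
  causal_b : ∀ i, Measurable[history ξ T i, ⊤] (b (i + 1))

/-- Age of information in slot `t`: `t - (S i - b i)`, where `i` is the last feature delivered by
slot `t` (`i ≤ t`, as transmission times are at least `1`), and `a₀ + t` before the first
delivery. -/
def age (S : ℕ → Ω → ℕ∞) (b : ℕ → Ω → ℕ) (T : ℕ → Ω → ℕ) (a₀ t : ℕ) (ω : Ω) : ℕ :=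
  open Classical in
  if delivery S T 0 ω ≤ t then
    let i := Nat.findGreatest (fun j => delivery S T j ω ≤ t) t
    t - (S i ω).toNat + b i ω
  else a₀ + t

section Cost

variable [MeasurableSpace Ω] [MeasurableSpace Ξ]

/-- The age process of a causal policy. -/
def CausalPolicy.age {ξ : Ω → Ξ} {T : ℕ → Ω → ℕ} {B : ℕ} {b₀ : Fin B}
    (π : CausalPolicy ξ T B b₀) (a₀ t : ℕ) (ω : Ω) : ℕ :=
  FeatureBuffer.age π.S (fun i ω => (π.b i ω : ℕ)) T a₀ t ω

/-- Long-run time-average expected penalty of a causal policy. -/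
def avgCost (μ : Measure Ω) (p : ℕ → ℝ) (a₀ : ℕ) {ξ : Ω → Ξ} {T : ℕ → Ω → ℕ} {B : ℕ}
    {b₀ : Fin B} (π : CausalPolicy ξ T B b₀) : ℝ :=
  limsup (fun n : ℕ => (1 / (n : ℝ)) * ∫ ω, ∑ t ∈ Finset.range n, p (π.age a₀ t ω) ∂μ) atTop

/-- Optimal value over all causal policies. -/
def optValue (μ : Measure Ω) (p : ℕ → ℝ) (a₀ : ℕ) (ξ : Ω → Ξ) (T : ℕ → Ω → ℕ) (B : ℕ)
    (b₀ : Fin B) : ℝ :=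
  ⨅ π : CausalPolicy ξ T B b₀, avgCost μ p a₀ π

/-- Optimal value over the causal policies that always select buffer position `b`. -/
def fixedOptValue (μ : Measure Ω) (p : ℕ → ℝ) (a₀ : ℕ) (ξ : Ω → Ξ) (T : ℕ → Ω → ℕ) (B : ℕ)
    (b₀ b : Fin B) : ℝ :=
  ⨅ π : {π : CausalPolicy ξ T B b₀ // ∀ i ω, π.b (i + 1) ω = b}, avgCost μ p a₀ π.1

/-- Gittins index
`γ(δ) = inf_{τ ≥ 1} (1/τ) ∑_{k < τ} E[p(δ + k + T₁)]`. -/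
def gittins (μ : Measure Ω) (p : ℕ → ℝ) (T : ℕ → Ω → ℕ) (δ : ℕ) : ℝ :=
  ⨅ m : ℕ, (1 / ((m + 1 : ℕ) : ℝ)) * ∑ k ∈ Finset.range (m + 1), ∫ ω, p (δ + k + T 1 ω) ∂μ

/-- Submission times `S 0 = 0`,
`S (i+1) = min {t ≥ D i : γ(t - S i + b) ≥ θ}` of the Gittins-index threshold rule with threshold
`θ` and constant buffer position `b`; the value is `⊤` if there is no such `t`. -/
def thresholdSubmit (μ : Measure Ω) (p : ℕ → ℝ) (T : ℕ → Ω → ℕ) (b : ℕ) (θ : ℝ) :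
    ℕ → Ω → ℕ∞
  | 0, _ => 0
  | i + 1, ω =>
    sInf {s : ℕ∞ | ∃ t : ℕ, s = t ∧
      thresholdSubmit μ p T b θ i ω + (T i ω : ℕ∞) ≤ t ∧
      θ ≤ gittins μ p T (t - (thresholdSubmit μ p T b θ i ω).toNat + b)}

/-- `β` is a root of
`E[∑_{t = D i}^{D (i+1) - 1} p(Δ(t))] - β E[D (i+1) - D i] = 0` (for every `i`), where the
features are sent by the threshold rule with threshold `β` and position `b`, so that
`Δ(t) = t - S i + b` between `D i` and `D (i+1)`.  The equation has a meaning only if the submission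
times exist almost surely and the mean cycle length is finite, which is part of being a root. -/
def IsRoot (μ : Measure Ω) (p : ℕ → ℝ) (T : ℕ → Ω → ℕ) (b : ℕ) (β : ℝ) : Prop :=
  let S := thresholdSubmit μ p T b β
  let D : ℕ → Ω → ℕ := fun i ω => (delivery S T i ω).toNat
  ∀ i : ℕ,
    (∀ᵐ ω ∂μ, S (i + 1) ω ≠ ⊤) ∧
    Integrable (fun ω => (D (i + 1) ω : ℝ) - (D i ω : ℝ)) μ ∧
    (∫ ω, ∑ t ∈ Finset.Ico (D i ω) (D (i + 1) ω), p (t - (S i ω).toNat + b) ∂μ)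
      - β * ∫ ω, ((D (i + 1) ω : ℝ) - (D i ω : ℝ)) ∂μ = 0

end Cost

end FeatureBuffer

end

/-!
The theorem is a renewal-reward argument for a Markov decision problem whose stages are the cycles
from one delivery to the next. Let `ν` be the law of a transmission time and `q δ` the mean of
`p (δ + T)`. If a cycle starts at age `x` and the next feature is submitted after `w` idle slots, its
mean excess penalty over a reference rate `β` is, up to a term that does not depend on `w`, the sum of
`q (x + k) - β` over `k < w` (`integral_excess_add`). Choosing `w` is thus a deterministic stopping
problem. An age `δ` has Gittins index at least `β` exactly if all partial sums of `q - β` from `δ` on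
are nonnegative (`Ready`, `Channel.le_gittins_iff`), so the first such age minimizes the sum
(`excess_waitTime_le`). Averaging the minimum over the transmission time at whose end the cycle
starts gives `rootFun ν p β b`, and the roots for `b` are its zeros in `β`, provided that a ready
age is reached after a time of finite mean (`WellPosed`, `Channel.isRoot_iff`).

For fixed `b` the root function is an infimum of functions affine in `β` with slopes at most `-1`. The
single inequality `cycleValue_le_add` makes this precise and yields uniqueness of the root and
continuity. Below the lower Cesàro limit of `p` the partial sums of `q - β` grow linearly, so every
threshold there is well posed; the root function is positive for very negative `β`, so a root exists as
soon as the function is nonpositive somewhere below that limit.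

For every causal policy, the buffer position of a feature is independent of its transmission time,
and the waiting time after its delivery is independent of the next transmission time. By
`integral_apply_of_indep`, used twice, the mean excess of each cycle is at least the mean of the root
function at the position in use, with equality for the threshold rule. For a horizon `n`,
`abs_sum_age_sub_sum_excess_le` compares the excess up to slot `n` with that of the cycles of all
features submitted before `n`, the last one being shortened. The difference is an overshoot of a
few cycle lengths, whose mean is `o(n)` because the cycle lengths are dominated by identically
distributed variables of finite mean. Hence the average cost of a policy is at least `β` when the root
function is nonnegative at `β` for all positions used (`CausalPolicy.le_avgCost`), and the threshold
policy for a root attains it (`CausalPolicy.avgCost_le`). If the root function were positive at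
some `β` between the optimal value for the position `b` and the Cesàro limit, the lower bound would
contradict the choice of `β`; this gives existence. With `β` the least of the roots, the two
bounds give the optimal value and the optimal policy.
-/

noncomputable section

namespace FeatureBuffer

section StoppingProblem


/-! ### The stopping problem within one cycle -/

/-- Total excess of `f` over the reference rate `β` in `m` slots, starting at age `x`. -/
def excess (f : ℕ → ℝ) (β : ℝ) (x m : ℕ) : ℝ :=
  ∑ k ∈ Finset.range m, (f (x + k) - β)

@[simp] lemma excess_zero (f : ℕ → ℝ) (β : ℝ) (x : ℕ) : excess f β x 0 = 0 := by
  simp [excess]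

lemma excess_add (f : ℕ → ℝ) (β : ℝ) (x m n : ℕ) :
    excess f β x (m + n) = excess f β x m + excess f β (x + m) n := by
  simp only [excess, Finset.sum_range_add, add_assoc]

lemma excess_succ (f : ℕ → ℝ) (β : ℝ) (x m : ℕ) :
    excess f β x (m + 1) = excess f β x m + (f (x + m) - β) := by
  rw [excess, excess, Finset.sum_range_succ]

lemma excess_eq_sum_sub (f : ℕ → ℝ) (β : ℝ) (x m : ℕ) :
    excess f β x m = ∑ k ∈ Finset.range m, f (x + k) - β * m := by
  simp [excess, mul_comm]

lemma excess_change (f : ℕ → ℝ) (β β' : ℝ) (x m : ℕ) :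
    excess f β' x m = excess f β x m + (β - β') * m := by
  rw [excess_eq_sum_sub, excess_eq_sum_sub]; ring

lemma abs_excess_le {f : ℕ → ℝ} {M : ℝ} (hf : ∀ δ, |f δ| ≤ M) (β : ℝ) (x m : ℕ) :
    |excess f β x m| ≤ (M + |β|) * m := by
  calc |excess f β x m| ≤ ∑ k ∈ Finset.range m, |f (x + k) - β| :=
        Finset.abs_sum_le_sum_abs _ _
    _ ≤ ∑ _k ∈ Finset.range m, (M + |β|) :=
        Finset.sum_le_sum fun k _ => (abs_sub _ _).trans (by gcongr; exact hf _)
    _ = (M + |β|) * m := by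
        rw [Finset.sum_const, Finset.card_range, nsmul_eq_mul, mul_comm]

/-- At age `δ`, postponing the submission by any number of slots costs at least the rate `β`.
When `f δ` is the mean of `p (δ + T)`, this says that the Gittins index of `δ` is at
least `β`. -/
def Ready (f : ℕ → ℝ) (β : ℝ) (δ : ℕ) : Prop :=
  ∀ m, 0 ≤ excess f β δ m

lemma Ready.mono {f : ℕ → ℝ} {β β' : ℝ} {δ : ℕ} (h : Ready f β δ) (hβ : β' ≤ β) :
    Ready f β' δ := fun m => by
  rw [excess_change f β]
  have := h m
  have : 0 ≤ (β - β') * m := mul_nonneg (by linarith) (Nat.cast_nonneg m)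
  linarith

/-- Number of idle slots, from age `x` on, until the first age that is ready; it is `0` if there is
no such age. -/
def waitTime (f : ℕ → ℝ) (β : ℝ) (x : ℕ) : ℕ :=
  sInf {z | Ready f β (x + z)}

lemma ready_waitTime {f : ℕ → ℝ} {β : ℝ} {x : ℕ} (h : ∃ z, Ready f β (x + z)) :
    Ready f β (x + waitTime f β x) :=
  Nat.sInf_mem (s := {z | Ready f β (x + z)}) h

lemma waitTime_le {f : ℕ → ℝ} {β : ℝ} {x z : ℕ} (h : Ready f β (x + z)) :
    waitTime f β x ≤ z :=
  Nat.sInf_le h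

lemma waitTime_mono {f : ℕ → ℝ} {β β' : ℝ} {x : ℕ} (hβ : β' ≤ β)
    (h : ∃ z, Ready f β (x + z)) : waitTime f β' x ≤ waitTime f β x :=
  waitTime_le ((ready_waitTime h).mono hβ)

/-- The first ready age is an optimal stopping place: from an age that is not ready, some
continuation has negative excess, and from a ready one no continuation has. -/
lemma excess_waitTime_le {f : ℕ → ℝ} {β : ℝ} {x : ℕ} (h : ∃ z, Ready f β (x + z)) (z : ℕ) :
    excess f β x (waitTime f β x) ≤ excess f β x z := by
  set w := waitTime f β x with hw
  have after : ∀ z, w ≤ z → excess f β x w ≤ excess f β x z := by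
    intro z hz
    obtain ⟨m, rfl⟩ := Nat.exists_eq_add_of_le hz
    rw [excess_add]
    have := ready_waitTime h m
    linarith
  -- induction on the number of slots that are left until the first ready age
  induction hd : w - z using Nat.strong_induction_on generalizing z with
  | _ d ih =>
    rcases le_or_gt w z with hz | hz
    · exact after z hz
    · have hnot : ¬ Ready f β (x + z) := fun hr => absurd (waitTime_le hr) (by omega)
      simp only [Ready, not_forall, not_le] at hnot
      obtain ⟨m, hm⟩ := hnot
      have hm0 : m ≠ 0 := by rintro rfl; simp at hm
      have step : excess f β x (z + m) ≤ excess f β x z := by rw [excess_add]; linarith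
      exact (ih (w - (z + m)) (by omega) (z + m) rfl).trans step

/-! ### Mean values under the law of a transmission time -/

/-- Mean penalty in the slot of delivery if a feature is submitted at age `δ`. -/
def meanPenalty (ν : Measure ℕ) (p : ℕ → ℝ) (δ : ℕ) : ℝ :=
  ∫ j, p (δ + j) ∂ν

/-- Mean excess penalty in a cycle that starts at age `x`, if the next feature is submitted at the
first ready age. -/
def cycleValue (ν : Measure ℕ) (p : ℕ → ℝ) (β : ℝ) (x : ℕ) : ℝ :=
  ∫ j, excess p β x (waitTime (meanPenalty ν p) β x + j) ∂ν

/-- Mean excess penalty in a cycle that starts with the delivery of a feature from buffer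
position `b`; a root for `b` is a zero of this function of `β`. -/
def rootFun (ν : Measure ℕ) (p : ℕ → ℝ) (β : ℝ) (b : ℕ) : ℝ :=
  ∫ j, cycleValue ν p β (j + b) ∂ν

/-- With threshold `β` and buffer position `b`, a ready age is almost surely reached, after a waiting
time of finite mean. -/
def WellPosed (ν : Measure ℕ) (p : ℕ → ℝ) (β : ℝ) (b : ℕ) : Prop :=
  (∀ᵐ j ∂ν, ∃ z, Ready (meanPenalty ν p) β (j + b + z)) ∧
    Integrable (fun j : ℕ => (waitTime (meanPenalty ν p) β (j + b) : ℝ)) ν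

lemma WellPosed.mono {ν : Measure ℕ} {p : ℕ → ℝ} {β β' : ℝ} {b : ℕ} (h : WellPosed ν p β b) (hβ : β' ≤ β) :
    WellPosed ν p β' b := by
  refine ⟨h.1.mono fun j ⟨z, hz⟩ => ⟨z, hz.mono hβ⟩, ?_⟩
  refine h.2.mono' Measurable.of_discrete.aestronglyMeasurable (h.1.mono fun j hj => ?_)
  simpa using waitTime_mono hβ hj

variable {ν : Measure ℕ} [IsProbabilityMeasure ν] {p : ℕ → ℝ} {M : ℝ}

lemma abs_meanPenalty_le (hp : ∀ δ, |p δ| ≤ M) (δ : ℕ) : |meanPenalty ν p δ| ≤ M := by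
  have := norm_integral_le_of_norm_le_const (μ := ν) (f := fun j => p (δ + j)) (C := M)
    (ae_of_all _ fun _ => hp _)
  simpa [meanPenalty] using this

lemma integrable_penalty (hp : ∀ δ, |p δ| ≤ M) (δ : ℕ) : Integrable (fun j => p (δ + j)) ν :=
  Integrable.of_bound (Measurable.of_discrete.aestronglyMeasurable) M (ae_of_all _ fun _ => hp _)

lemma integrable_excess (hp : ∀ δ, |p δ| ≤ M) (hν : Integrable (fun j : ℕ => (j : ℝ)) ν)
    (β : ℝ) (x w : ℕ) : Integrable (fun j => excess p β x (w + j)) ν := by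
  refine Integrable.mono' (((integrable_const (w : ℝ)).add hν).const_mul (M + |β|))
    Measurable.of_discrete.aestronglyMeasurable (ae_of_all _ fun j => ?_)
  simpa using abs_excess_le hp β x (w + j)

/-- Waiting `w` slots changes the mean excess of the cycle by the excess of the mean penalty
over the waiting slots: each slot of waiting adds one slot at the end of the transmission. -/
lemma integral_excess_add (hp : ∀ δ, |p δ| ≤ M) (hν : Integrable (fun j : ℕ => (j : ℝ)) ν)
    (β : ℝ) (x w : ℕ) :
    ∫ j, excess p β x (w + j) ∂ν =
      ∫ j, excess p β x j ∂ν + excess (meanPenalty ν p) β x w := by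
  induction w with
  | zero => simp
  | succ w ih =>
    have h : ∀ j, excess p β x (w + 1 + j) = excess p β x (w + j) + (p (x + w + j) - β) := by
      intro j
      rw [show w + 1 + j = w + j + 1 by ring, excess_succ, add_assoc x w j]
    simp_rw [h]
    rw [integral_add (integrable_excess hp hν β x w)
      (g := fun j => p (x + w + j) - β)
      ((integrable_penalty hp (x + w)).sub (integrable_const β)), ih,
      integral_sub (integrable_penalty hp (x + w)) (integrable_const β), excess_succ]
    simp [meanPenalty, add_assoc]

lemma cycleValue_le (hp : ∀ δ, |p δ| ≤ M) (hν : Integrable (fun j : ℕ => (j : ℝ)) ν)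
    {β : ℝ} {x : ℕ} (h : ∃ z, Ready (meanPenalty ν p) β (x + z)) (w : ℕ) :
    cycleValue ν p β x ≤ ∫ j, excess p β x (w + j) ∂ν := by
  rw [cycleValue, integral_excess_add hp hν, integral_excess_add hp hν]
  linarith [excess_waitTime_le h w]

/-- Using the waiting time for the threshold `β` in the problem with reference rate `β'`. This one
inequality yields monotonicity, strict monotonicity and continuity in the threshold. -/
lemma cycleValue_le_add (hp : ∀ δ, |p δ| ≤ M) (hν : Integrable (fun j : ℕ => (j : ℝ)) ν)
    {β β' : ℝ} {x : ℕ} (h : ∃ z, Ready (meanPenalty ν p) β' (x + z)) :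
    cycleValue ν p β' x ≤ cycleValue ν p β x +
      (β - β') * (waitTime (meanPenalty ν p) β x + ∫ j, (j : ℝ) ∂ν) := by
  refine (cycleValue_le hp hν h (waitTime (meanPenalty ν p) β x)).trans_eq ?_
  simp_rw [excess_change p β β']
  rw [integral_add (integrable_excess hp hν β x _), cycleValue, integral_const_mul]
  · simp only [Nat.cast_add]
    rw [integral_add (integrable_const _) hν]
    simp
  · simp only [Nat.cast_add]
    exact ((integrable_const _).add hν).const_mul _

lemma abs_cycleValue_le (hp : ∀ δ, |p δ| ≤ M) (hν : Integrable (fun j : ℕ => (j : ℝ)) ν)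
    (β : ℝ) (x : ℕ) :
    |cycleValue ν p β x| ≤
      (M + |β|) * (waitTime (meanPenalty ν p) β x + ∫ j, (j : ℝ) ∂ν) := by
  set w := waitTime (meanPenalty ν p) β x with hw
  have hint : Integrable (fun j : ℕ => (M + |β|) * ((w : ℝ) + j)) ν :=
    ((integrable_const _).add hν).const_mul _
  calc |cycleValue ν p β x| ≤ ∫ j, (M + |β|) * ((w : ℝ) + j) ∂ν := by
        rw [← Real.norm_eq_abs]
        refine norm_integral_le_of_norm_le hint (ae_of_all _ fun j => ?_)
        simpa using abs_excess_le hp β x (w + j)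
    _ = _ := by
        rw [integral_const_mul, integral_add (integrable_const _) hν]
        simp

lemma WellPosed.integrable_cycleValue {β : ℝ} {b : ℕ} (h : WellPosed ν p β b)
    (hp : ∀ δ, |p δ| ≤ M) (hν : Integrable (fun j : ℕ => (j : ℝ)) ν) :
    Integrable (fun j => cycleValue ν p β (j + b)) ν :=
  Integrable.mono' ((h.2.add (integrable_const (∫ j, (j : ℝ) ∂ν))).const_mul (M + |β|))
    Measurable.of_discrete.aestronglyMeasurable
    (ae_of_all _ fun j => abs_cycleValue_le hp hν β (j + b))

lemma WellPosed.rootFun_le_add {β β' : ℝ} {b : ℕ} (h : WellPosed ν p β b)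
    (h' : WellPosed ν p β' b) (hp : ∀ δ, |p δ| ≤ M)
    (hν : Integrable (fun j : ℕ => (j : ℝ)) ν) :
    rootFun ν p β' b ≤ rootFun ν p β b + (β - β') *
      (∫ j, (waitTime (meanPenalty ν p) β (j + b) : ℝ) ∂ν + ∫ j, (j : ℝ) ∂ν) := by
  have h1 : Integrable (fun j => (waitTime (meanPenalty ν p) β (j + b) : ℝ) +
      ∫ j, (j : ℝ) ∂ν) ν := h.2.add (integrable_const _)
  calc rootFun ν p β' b ≤ ∫ j, (cycleValue ν p β (j + b) + (β - β') *
        (waitTime (meanPenalty ν p) β (j + b) + ∫ j, (j : ℝ) ∂ν)) ∂ν :=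
        integral_mono_ae (h'.integrable_cycleValue hp hν)
          ((h.integrable_cycleValue hp hν).add (h1.const_mul _))
          (h'.1.mono fun j hj => cycleValue_le_add hp hν hj)
    _ = _ := by
        rw [integral_add (h.integrable_cycleValue hp hν) (h1.const_mul _), integral_const_mul,
          integral_add h.2 (integrable_const _), rootFun]
        simp

lemma WellPosed.rootFun_antitone {β β' : ℝ} {b : ℕ} (h : WellPosed ν p β b)
    (hβ : β' ≤ β) (hp : ∀ δ, |p δ| ≤ M) (hν : Integrable (fun j : ℕ => (j : ℝ)) ν) :
    rootFun ν p β b ≤ rootFun ν p β' b := by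
  refine ((h.mono hβ).rootFun_le_add h hp hν).trans ?_
  have : 0 ≤ ∫ j, (waitTime (meanPenalty ν p) β' (j + b) : ℝ) ∂ν + ∫ j, (j : ℝ) ∂ν :=
    add_nonneg (integral_nonneg fun j => Nat.cast_nonneg _)
      (integral_nonneg fun j => Nat.cast_nonneg _)
  nlinarith

lemma one_le_mean (hν : Integrable (fun j : ℕ => (j : ℝ)) ν) (hν1 : ∀ᵐ j ∂ν, 1 ≤ j) :
    1 ≤ ∫ j, (j : ℝ) ∂ν := by
  have := integral_mono_ae (integrable_const (μ := ν) (1 : ℝ)) hν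
    (hν1.mono fun j hj => by simpa using hj)
  simpa using this

/-- The root function is strictly decreasing, as a cycle lasts at least one slot. -/
lemma root_unique (hp : ∀ δ, |p δ| ≤ M) (hν : Integrable (fun j : ℕ => (j : ℝ)) ν)
    (hν1 : ∀ᵐ j ∂ν, 1 ≤ j) {b : ℕ} {β β' : ℝ} (h : WellPosed ν p β b)
    (h0 : rootFun ν p β b = 0) (h' : WellPosed ν p β' b) (h0' : rootFun ν p β' b = 0) :
    β = β' := by
  have key : ∀ {β β' : ℝ}, WellPosed ν p β b → rootFun ν p β b = 0 → WellPosed ν p β' b →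
      rootFun ν p β' b = 0 → β' ≤ β := by
    intro β β' h h0 h' h0'
    have h1 := h.rootFun_le_add h' hp hν
    have h2 := one_le_mean hν hν1
    have h3 : 0 ≤ ∫ j, (waitTime (meanPenalty ν p) β (j + b) : ℝ) ∂ν :=
      integral_nonneg fun j => Nat.cast_nonneg _
    rw [h0, h0', zero_add] at h1
    by_contra hlt
    nlinarith
  exact le_antisymm (key h' h0' h h0) (key h h0 h' h0')

/-! ### Thresholds below the long-run average penalty -/

/-- Below the lower Cesàro limit of `p`, the total excess of the mean penalty grows linearly. -/
lemma exists_linear_le_excess (hp : ∀ δ, |p δ| ≤ M) (hν : Integrable (fun j : ℕ => (j : ℝ)) ν)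
    {β : ℝ} (hβ : β < liminf (fun n : ℕ => (1 / (n : ℝ)) * ∑ δ ∈ Finset.range n, p δ) atTop) :
    ∃ ε > 0, ∃ C : ℝ, ∀ n : ℕ, ε * n - C ≤ excess (meanPenalty ν p) β 0 n := by
  obtain ⟨β₁, hβ₁, hβ₁'⟩ := exists_between hβ
  have hM : 0 ≤ M := (abs_nonneg _).trans (hp 0)
  have hsum : ∀ x n : ℕ, |∑ δ ∈ Finset.range n, p (x + δ)| ≤ M * n := fun x n => by
    simpa [excess] using abs_excess_le hp 0 x n
  have hbdd : IsBoundedUnder (· ≥ ·) atTop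
      (fun n : ℕ => (1 / (n : ℝ)) * ∑ δ ∈ Finset.range n, p δ) := by
    refine isBoundedUnder_of ⟨-M, fun n => ?_⟩
    rcases Nat.eq_zero_or_pos n with rfl | hn
    · simpa using hM
    · have hn' : (0 : ℝ) < n := by exact_mod_cast hn
      have := neg_le_of_abs_le (by simpa using hsum 0 n)
      rw [ge_iff_le, one_div, inv_mul_eq_div, le_div_iff₀ hn']
      linarith
  obtain ⟨N, hN⟩ := eventually_atTop.1 (eventually_lt_of_lt_liminf hβ₁' hbdd)
  have hlin : ∀ n : ℕ, β₁ * n - (M + |β₁|) * N ≤ ∑ δ ∈ Finset.range n, p δ := by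
    intro n
    have hc : 0 ≤ (M + |β₁|) * N := by positivity
    have hn0 : (0 : ℝ) ≤ n := Nat.cast_nonneg n
    rcases Nat.eq_zero_or_pos n with rfl | hn
    · simpa using hc
    rcases le_or_gt N n with h | h
    · have hn' : (0 : ℝ) < n := by exact_mod_cast hn
      have := hN n h
      rw [one_div, inv_mul_eq_div, lt_div_iff₀ hn'] at this
      linarith
    · have h1 := neg_le_of_abs_le (by simpa using hsum 0 n)
      have h2 : (M + |β₁|) * n ≤ (M + |β₁|) * N := by gcongr
      nlinarith [le_abs_self β₁]
  refine ⟨β₁ - β, sub_pos.2 hβ₁, (M + |β₁|) * N + (M + |β₁|) * ∫ j, (j : ℝ) ∂ν, fun n => ?_⟩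
  have hswap : ∑ k ∈ Finset.range n, meanPenalty ν p k =
      ∫ j, ∑ k ∈ Finset.range n, p (j + k) ∂ν := by
    rw [integral_finsetSum]
    · simp [meanPenalty, add_comm]
    · intro k _
      simpa [add_comm] using integrable_penalty (ν := ν) hp k
  have hpt : ∀ j : ℕ, β₁ * n - (M + |β₁|) * N - (M + |β₁|) * j ≤
      ∑ k ∈ Finset.range n, p (j + k) := by
    intro j
    have h1 := hlin (j + n)
    rw [Finset.sum_range_add] at h1
    have h2 := le_of_abs_le (by simpa using hsum 0 j)
    push_cast at h1
    nlinarith [neg_abs_le β₁, (Nat.cast_nonneg j : (0 : ℝ) ≤ j)]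
  have hmono := integral_mono (μ := ν)
    (f := fun j : ℕ => β₁ * n - (M + |β₁|) * N - (M + |β₁|) * (j : ℝ))
    ((integrable_const _).sub (hν.const_mul _))
    (integrable_finsetSum _ fun k _ => by
      simpa [add_comm] using integrable_penalty (ν := ν) hp k) hpt
  rw [← hswap, integral_sub (integrable_const _) (hν.const_mul _), integral_const_mul] at hmono
  rw [excess_eq_sum_sub]
  simp only [integral_const, probReal_univ, one_smul] at hmono
  simp only [zero_add]
  linarith

lemma wellPosed_of_lt_liminf (hp : ∀ δ, |p δ| ≤ M) (hν : Integrable (fun j : ℕ => (j : ℝ)) ν)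
    {β : ℝ} (hβ : β < liminf (fun n : ℕ => (1 / (n : ℝ)) * ∑ δ ∈ Finset.range n, p δ) atTop)
    (b : ℕ) : WellPosed ν p β b := by
  obtain ⟨ε, hε, C, hC⟩ := exists_linear_le_excess (ν := ν) hp hν hβ
  set f := meanPenalty ν p with hf
  have hex : ∀ x, ∃ z, Ready f β (x + z) := by
    intro x
    have htop : Tendsto (fun z : ℕ => excess f β 0 (x + z)) cofinite atTop := by
      rw [Nat.cofinite_eq_atTop]
      refine tendsto_atTop_mono (fun z => hC (x + z)) ?_
      have h1 : Tendsto (fun z : ℕ => ((x + z : ℕ) : ℝ)) atTop atTop :=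
        tendsto_natCast_atTop_atTop.comp (tendsto_add_atTop_nat x |>.congr fun z => by ring)
      exact tendsto_atTop_add_const_right _ _ (h1.const_mul_atTop hε)
    obtain ⟨z, hz⟩ := htop.exists_forall_le
    refine ⟨z, fun m => ?_⟩
    have := hz (z + m)
    rw [← add_assoc, excess_add f β 0 (x + z) m] at this
    simpa using this
  refine ⟨ae_of_all _ fun j => hex _, ?_⟩
  have hK : ∀ x : ℕ, ε * (waitTime f β x : ℝ) ≤ C + (M + |β|) * x := by
    intro x
    have h1 := excess_waitTime_le (hex x) 0
    have h2 := hC (x + waitTime f β x)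
    rw [excess_add] at h2
    have h3 := le_of_abs_le (abs_excess_le (abs_meanPenalty_le (ν := ν) hp) β 0 x)
    simp only [excess_zero, zero_add, Nat.cast_add] at h1 h2
    rw [← hf] at h3
    nlinarith [(Nat.cast_nonneg x : (0 : ℝ) ≤ x)]
  have hint : Integrable (fun j : ℕ => ε⁻¹ * (C + (M + |β|) * ((j : ℝ) + b))) ν :=
    ((integrable_const _).add ((hν.add (integrable_const _)).const_mul _)).const_mul _
  refine hint.mono' Measurable.of_discrete.aestronglyMeasurable (ae_of_all _ fun j => ?_)
  have := hK (j + b)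
  rw [Real.norm_eq_abs, abs_of_nonneg (Nat.cast_nonneg _), le_inv_mul_iff₀ hε]
  simpa using this

lemma rootFun_pos_of_le (hp : ∀ δ, |p δ| ≤ M) (hν : Integrable (fun j : ℕ => (j : ℝ)) ν)
    (hν1 : ∀ᵐ j ∂ν, 1 ≤ j) {β : ℝ} (hβ : β ≤ -M - 1) {b : ℕ} (h : WellPosed ν p β b) :
    0 < rootFun ν p β b := by
  have h1 : ∀ x, 1 ≤ cycleValue ν p β x := by
    intro x
    have := integral_mono_ae (integrable_const (μ := ν) (1 : ℝ))
      (integrable_excess hp hν β x (waitTime (meanPenalty ν p) β x)) (hν1.mono fun j hj => ?_)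
    · simpa [cycleValue] using this
    · set m := waitTime (meanPenalty ν p) β x + j with hm
      have h2 : ∑ _k ∈ Finset.range m, (1 : ℝ) ≤ excess p β x m :=
        Finset.sum_le_sum fun k _ => by linarith [neg_le_of_abs_le (hp (x + k))]
      have h3 : (1 : ℝ) ≤ m := by exact_mod_cast (by omega : 1 ≤ m)
      simp only [Finset.sum_const, Finset.card_range, nsmul_eq_mul, mul_one] at h2
      exact h3.trans h2
  have := integral_mono (integrable_const (μ := ν) (1 : ℝ)) (h.integrable_cycleValue hp hν)
    fun j => h1 (j + b)
  simp only [integral_const, probReal_univ, one_smul] at this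
  exact one_pos.trans_le this

/-- If the root function is nonpositive at a well-posed threshold, it has a zero, by continuity. -/
lemma exists_root_of_rootFun_nonpos (hp : ∀ δ, |p δ| ≤ M)
    (hν : Integrable (fun j : ℕ => (j : ℝ)) ν) (hν1 : ∀ᵐ j ∂ν, 1 ≤ j) {β₁ : ℝ} {b : ℕ}
    (h : WellPosed ν p β₁ b) (h0 : rootFun ν p β₁ b ≤ 0) :
    ∃ β, WellPosed ν p β b ∧ rootFun ν p β b = 0 := by
  set β₀ := min β₁ (-M - 1)
  have hle : β₀ ≤ β₁ := min_le_left _ _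
  set K := ∫ j, (waitTime (meanPenalty ν p) β₁ (j + b) : ℝ) ∂ν + ∫ j, (j : ℝ) ∂ν with hK
  have hK0 : 0 ≤ K :=
    add_nonneg (integral_nonneg fun j => Nat.cast_nonneg _)
      (integral_nonneg fun j => Nat.cast_nonneg _)
  have hlip : LipschitzOnWith K.toNNReal (fun β => rootFun ν p β b) (Set.Icc β₀ β₁) := by
    refine LipschitzOnWith.of_le_add_mul _ fun β' hβ' β hβ => ?_
    refine ((h.mono hβ.2).rootFun_le_add (h.mono hβ'.2) hp hν).trans ?_
    have h1 : ∫ j, (waitTime (meanPenalty ν p) β (j + b) : ℝ) ∂ν + ∫ j, (j : ℝ) ∂ν ≤ K :=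
      add_le_add_left (integral_mono_ae (h.mono hβ.2).2 h.2
        (h.1.mono fun j hj => by simpa using waitTime_mono hβ.2 hj)) _
    have h2 : 0 ≤ ∫ j, (waitTime (meanPenalty ν p) β (j + b) : ℝ) ∂ν + ∫ j, (j : ℝ) ∂ν :=
      add_nonneg (integral_nonneg fun j => Nat.cast_nonneg _)
        (integral_nonneg fun j => Nat.cast_nonneg _)
    rw [Real.coe_toNNReal _ hK0, dist_comm, Real.dist_eq, mul_comm K]
    gcongr
    exact le_abs_self _
  obtain ⟨β, hβ, hβ0⟩ := intermediate_value_Icc' hle hlip.continuousOn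
    ⟨h0, (rootFun_pos_of_le hp hν hν1 (min_le_right _ _) (h.mono hle)).le⟩
  exact ⟨β, h.mono hβ.2, hβ0⟩

end StoppingProblem

section PathAndPast


variable {Ω : Type*} {Ξ : Type*}

/-! ### The path of the age -/

section Path

variable {S : ℕ → Ω → ℕ∞} {b : ℕ → Ω → ℕ} {T : ℕ → Ω → ℕ} {ω : Ω}

lemma delivery_mono (hd : ∀ i, delivery S T i ω ≤ S (i + 1) ω) :
    Monotone fun i => delivery S T i ω :=
  monotone_nat_of_le_succ fun i => (hd i).trans le_self_add

lemma submit_mono (hd : ∀ i, delivery S T i ω ≤ S (i + 1) ω) : Monotone fun i => S i ω :=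
  monotone_nat_of_le_succ fun i => le_self_add.trans (hd i)

lemma le_submit (hd : ∀ i, delivery S T i ω ≤ S (i + 1) ω) (hT : ∀ i, 1 ≤ T i ω) (i : ℕ) :
    (i : ℕ∞) ≤ S i ω := by
  induction i with
  | zero => simp
  | succ i ih =>
    refine le_trans ?_ (hd i)
    rw [delivery, Nat.cast_add]
    exact add_le_add ih (by exact_mod_cast hT i)

lemma age_eq (hd : ∀ i, delivery S T i ω ≤ S (i + 1) ω) (hT : ∀ i, 1 ≤ T i ω) (a₀ : ℕ)
    {i t : ℕ} (h : delivery S T i ω ≤ t) (h' : (t : ℕ∞) < delivery S T (i + 1) ω) :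
    age S b T a₀ t ω = t - (S i ω).toNat + b i ω := by
  classical
  have hfind : Nat.findGreatest (fun j => delivery S T j ω ≤ t) t = i := by
    rw [Nat.findGreatest_eq_iff]
    refine ⟨?_, fun _ => h, fun n hn _ => not_le.2 (h'.trans_le (delivery_mono hd hn))⟩
    exact_mod_cast (le_submit hd hT i).trans (le_self_add.trans h)
  rw [age, if_pos ((delivery_mono hd (Nat.zero_le i)).trans h)]
  simp only [← hfind]

/-- The excess accumulated from the delivery of feature `i` on, up to the next delivery at most. -/
lemma excess_eq_sum_age (hd : ∀ i, delivery S T i ω ≤ S (i + 1) ω) (hT : ∀ i, 1 ≤ T i ω)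
    (a₀ : ℕ) (p : ℕ → ℝ) (β : ℝ) {i m : ℕ} (hi : S i ω ≠ ⊤)
    (hm : delivery S T i ω + m ≤ delivery S T (i + 1) ω) :
    excess p β (T i ω + b i ω) m =
      ∑ t ∈ Finset.Ico (delivery S T i ω).toNat ((delivery S T i ω).toNat + m),
        (p (age S b T a₀ t ω) - β) := by
  obtain ⟨s, hs⟩ := ENat.ne_top_iff_exists.1 hi
  have hD : delivery S T i ω = ((s + T i ω : ℕ) : ℕ∞) := by simp [delivery, ← hs]
  rw [hD] at hm ⊢
  rw [ENat.toNat_natCast, Finset.sum_Ico_eq_sum_range, add_tsub_cancel_left, excess]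
  refine Finset.sum_congr rfl fun k hk => ?_
  rw [age_eq hd hT a₀ (i := i), ← hs, ENat.toNat_natCast]
  · congr 2
    omega
  · rw [hD]
    exact_mod_cast Nat.le_add_right _ _
  · refine lt_of_lt_of_le ?_ hm
    exact_mod_cast Nat.add_lt_add_left (Finset.mem_range.1 hk) _

/-- The excess up to slot `n` differs from the sum over the cycles of the features submitted
before `n` by the part before the first delivery and the overshoot of the last of these cycles.
The last cycle may be shortened: `W i` is the time from the delivery of feature `i` until the
submission of the next one, but for the last feature submitted before `n` it need only reach
slot `n`. -/
lemma abs_sum_age_sub_sum_excess_le (h0 : S 0 ω = 0)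
    (hd : ∀ i, delivery S T i ω ≤ S (i + 1) ω) (hT : ∀ i, 1 ≤ T i ω) (a₀ : ℕ)
    {p : ℕ → ℝ} {M : ℝ} (hp : ∀ δ, |p δ| ≤ M) (β : ℝ) {n : ℕ} (hn : 0 < n) (W R : ℕ → ℕ)
    (hW : ∀ i, S (i + 1) ω < n → delivery S T i ω + W i = S (i + 1) ω)
    (hW_le : ∀ i, S i ω < n → delivery S T i ω + W i ≤ S (i + 1) ω)
    (hW_ge : ∀ i, S i ω < n → n ≤ S (i + 1) ω → n ≤ delivery S T i ω + W i)
    (hR : ∀ i, S i ω < n → n ≤ S (i + 1) ω →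
      delivery S T i ω + W i + T (i + 1) ω ≤ n + R i) :
    ∃ I < n, |∑ t ∈ Finset.range n, (p (age S b T a₀ t ω) - β) -
      ∑ i ∈ Finset.range n, (if S i ω < n then
        excess p β (T i ω + b i ω) (W i + T (i + 1) ω) else 0)| ≤
      (M + |β|) * (T 0 ω + R I) := by
  classical
  set a : ℕ → ℝ := fun t => p (age S b T a₀ t ω) - β with ha
  set X : ℕ → ℝ := fun i => excess p β (T i ω + b i ω) (W i + T (i + 1) ω) with hX
  set c : ℕ → ℕ := fun i => (delivery S T i ω).toNat with hc
  -- the last feature submitted before slot `n`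
  set I := Nat.findGreatest (fun i => S i ω < n) n with hI
  have hS0 : S 0 ω < n := by rw [h0]; exact_mod_cast hn
  have hIn : S I ω < n := Nat.findGreatest_spec (P := fun i => S i ω < n) (Nat.zero_le n) hS0
  have hI_lt : I < n := by exact_mod_cast (le_submit hd hT I).trans_lt hIn
  have hI1 : n ≤ S (I + 1) ω := not_lt.1
    (Nat.findGreatest_is_greatest (P := fun i => S i ω < n) (Nat.lt_succ_self I) hI_lt)
  have hlt_iff : ∀ i, S i ω < n ↔ i < I + 1 := fun i =>
    ⟨fun h => by
      by_contra hi
      exact absurd (hI1.trans (submit_mono hd (not_lt.1 hi))) (not_le.2 h),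
     fun h => (submit_mono hd (Nat.lt_succ_iff.1 h)).trans_lt hIn⟩
  have hne : ∀ i, i < I + 1 → S i ω ≠ ⊤ := fun i hi => ((hlt_iff i).2 hi).ne_top
  have hcD : ∀ i, i < I + 1 → delivery S T i ω = c i := fun i hi => by
    rw [hc]
    refine (ENat.natCast_toNat ?_).symm
    rw [delivery]
    exact WithTop.add_ne_top.2 ⟨hne i hi, ENat.natCast_ne_top _⟩
  have hcycle : ∀ i, i < I + 1 →
      X i = ∑ t ∈ Finset.Ico (c i) (c i + (W i + T (i + 1) ω)), a t := fun i hi => by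
    refine excess_eq_sum_age hd hT a₀ p β (hne i hi) ?_
    rw [Nat.cast_add, ← add_assoc, delivery.eq_1 S T (i + 1)]
    gcongr
    exact hW_le i ((hlt_iff i).2 hi)
  have hc0 : c 0 = T 0 ω := by simp [hc, delivery, h0]
  have hsum : ∀ i, i < I + 1 → T 0 ω ≤ c i ∧
      ∑ k ∈ Finset.range i, X k = ∑ t ∈ Finset.Ico (T 0 ω) (c i), a t := by
    intro i
    induction i with
    | zero => intro _; simp [hc0]
    | succ i ih =>
      intro hi
      have hi' : i < I + 1 := by omega
      obtain ⟨ih1, ih2⟩ := ih hi'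
      have hstep : c (i + 1) = c i + (W i + T (i + 1) ω) := by
        have h1 := hcD (i + 1) hi
        rw [delivery, ← hW i ((hlt_iff _).2 hi), hcD i hi'] at h1
        have h2 : c i + W i + T (i + 1) ω = c (i + 1) := by exact_mod_cast h1
        omega
      refine ⟨by omega, ?_⟩
      rw [Finset.sum_range_succ, ih2, hcycle i hi', hstep,
        Finset.sum_Ico_consecutive _ ih1 (by omega)]
  obtain ⟨hT0, hsumI⟩ := hsum I (Nat.lt_succ_self I)
  set e := c I + (W I + T (I + 1) ω) with he
  have hne' : n ≤ e := by
    have h1 := hW_ge I hIn hI1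
    rw [hcD I (Nat.lt_succ_self I)] at h1
    have h2 : n ≤ c I + W I := by exact_mod_cast h1
    omega
  have heR : e ≤ n + R I := by
    have h1 := hR I hIn hI1
    rw [hcD I (Nat.lt_succ_self I)] at h1
    have h2 : c I + W I + T (I + 1) ω ≤ n + R I := by exact_mod_cast h1
    omega
  have htotal : ∑ i ∈ Finset.range n, (if S i ω < n then X i else 0) =
      ∑ t ∈ Finset.Ico (T 0 ω) e, a t := by
    rw [← Finset.sum_filter]
    have : (Finset.range n).filter (fun i => S i ω < n) = Finset.range (I + 1) := by
      ext i
      simp only [Finset.mem_filter, Finset.mem_range, hlt_iff]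
      omega
    rw [this, Finset.sum_range_succ, hsumI, hcycle I (Nat.lt_succ_self I),
      Finset.sum_Ico_consecutive _ hT0 (by omega)]
  have habs : ∀ s : Finset ℕ, |∑ t ∈ s, a t| ≤ (M + |β|) * s.card := fun s => by
    calc |∑ t ∈ s, a t| ≤ ∑ t ∈ s, |a t| := Finset.abs_sum_le_sum_abs _ _
      _ ≤ ∑ _t ∈ s, (M + |β|) :=
          Finset.sum_le_sum fun t _ => (abs_sub _ _).trans (by gcongr; exact hp _)
      _ = (M + |β|) * s.card := by rw [Finset.sum_const, nsmul_eq_mul, mul_comm]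
  refine ⟨I, hI_lt, ?_⟩
  rw [htotal]
  have h1 : ∑ t ∈ Finset.range n, a t - ∑ t ∈ Finset.Ico (T 0 ω) e, a t =
      ∑ t ∈ Finset.range (T 0 ω), a t - ∑ t ∈ Finset.Ico n e, a t := by
    have h2 := Finset.sum_range_add_sum_Ico a (show T 0 ω ≤ e by omega)
    have h3 := Finset.sum_range_add_sum_Ico a hne'
    linarith
  have hc' : 0 ≤ M + |β| := add_nonneg ((abs_nonneg _).trans (hp 0)) (abs_nonneg _)
  have h4 : ((e - n : ℕ) : ℝ) ≤ R I := by exact_mod_cast (by omega : e - n ≤ R I)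
  rw [h1]
  calc _ ≤ |∑ t ∈ Finset.range (T 0 ω), a t| + |∑ t ∈ Finset.Ico n e, a t| := abs_sub _ _
    _ ≤ (M + |β|) * (T 0 ω) + (M + |β|) * (e - n : ℕ) := by
        have h5 := habs (Finset.range (T 0 ω))
        have h6 := habs (Finset.Ico n e)
        rw [Finset.card_range] at h5
        rw [Nat.card_Ico] at h6
        exact add_le_add h5 h6
    _ ≤ _ := by rw [mul_add]; gcongr

end Path

/-! ### Independence of the past -/

section Independence

/-- If `X` is independent of `(Y, Z)`, and `Y` of `Z`, then `(X, Y)` is independent of `Z`. -/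
lemma _root_.ProbabilityTheory.IndepFun.prodMk_indepFun {α β γ : Type*} [MeasurableSpace Ω]
    [MeasurableSpace α] [MeasurableSpace β] [MeasurableSpace γ] {μ : Measure Ω}
    [IsProbabilityMeasure μ] {X : Ω → α} {Y : Ω → β} {Z : Ω → γ} (hX : Measurable X)
    (hY : Measurable Y) (hZ : Measurable Z) (h : IndepFun X (fun ω => (Y ω, Z ω)) μ)
    (h' : IndepFun Y Z μ) : IndepFun (fun ω => (X ω, Y ω)) Z μ := by
  have := Measure.isProbabilityMeasure_map (μ := μ) hX.aemeasurable
  have := Measure.isProbabilityMeasure_map (μ := μ) hY.aemeasurable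
  have := Measure.isProbabilityMeasure_map (μ := μ) hZ.aemeasurable
  have hXY : IndepFun X Y μ := h.comp measurable_id measurable_fst
  rw [indepFun_iff_map_prod_eq_prod_map_map (hX.prodMk hY).aemeasurable hZ.aemeasurable,
    (indepFun_iff_map_prod_eq_prod_map_map hX.aemeasurable hY.aemeasurable).1 hXY]
  have h1 := (indepFun_iff_map_prod_eq_prod_map_map hX.aemeasurable
    (hY.prodMk hZ).aemeasurable).1 h
  rw [(indepFun_iff_map_prod_eq_prod_map_map hY.aemeasurable hZ.aemeasurable).1 h'] at h1
  have h2 := congrArg (Measure.map MeasurableEquiv.prodAssoc.symm) h1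
  rw [Measure.map_map MeasurableEquiv.prodAssoc.symm.measurable
    (hX.prodMk (hY.prodMk hZ))] at h2
  refine h2.trans ?_
  rw [← Measure.prodAssoc_prod, MeasurableEquiv.map_symm_map]

/-- Fubini's theorem for a random function `f` that is determined by `m`, evaluated at a discrete
random variable independent of `m`. -/
lemma integral_apply_of_indep {m mΩ : MeasurableSpace Ω} {μ : Measure Ω}
    [IsProbabilityMeasure μ] (hm : m ≤ mΩ) {X : Ω → ℕ} (hX : Measurable X)
    (hind : Indep m (MeasurableSpace.comap X ⊤) μ) {f : Ω → ℕ → ℝ}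
    (hf : ∀ j, Measurable[m] fun ω => f ω j) (hint : Integrable (fun ω => f ω (X ω)) μ) :
    Integrable (fun ω => ∫ j, f ω j ∂(μ.map X)) μ ∧
      ∫ ω, f ω (X ω) ∂μ = ∫ ω, ∫ j, f ω j ∂(μ.map X) ∂μ := by
  have hf_m : Measurable[m] f := (@measurable_pi_iff Ω ℕ (fun _ => ℝ) m _ f).2 hf
  have hf' : Measurable f := hf_m.mono hm le_rfl
  have hfX : IndepFun f X μ := by
    rw [IndepFun_iff_Indep]
    exact indep_of_indep_of_le_left hind hf_m.comap_le
  have hev : Measurable fun y : (ℕ → ℝ) × ℕ => y.1 y.2 :=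
    measurable_from_prod_countable_left fun j => measurable_pi_apply j
  have hprod := (indepFun_iff_map_prod_eq_prod_map_map hf'.aemeasurable hX.aemeasurable).1 hfX
  have := Measure.isProbabilityMeasure_map (μ := μ) hf'.aemeasurable
  have := Measure.isProbabilityMeasure_map (μ := μ) hX.aemeasurable
  have hint' : Integrable (fun y : (ℕ → ℝ) × ℕ => y.1 y.2) ((μ.map f).prod (μ.map X)) := by
    rw [← hprod, integrable_map_measure hev.aestronglyMeasurable (hf'.prodMk hX).aemeasurable]
    exact hint
  constructor
  · have := hint'.integral_prod_left
    exact (integrable_map_measure this.aestronglyMeasurable hf'.aemeasurable).1 this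
  · have h1 := integral_map (μ := μ) (hf'.prodMk hX).aemeasurable
      (hev.aestronglyMeasurable (μ := μ.map fun ω => (f ω, X ω)))
    rw [hprod, integral_prod _ hint'] at h1
    rw [← h1, integral_map hf'.aemeasurable hint'.integral_prod_left.aestronglyMeasurable]

variable [MeasurableSpace Ξ]

/-- The information on which `S i` and `b i` may depend: none for `i = 0`, and the history up to
feature `i - 1` otherwise. -/
@[reducible] def past (ξ : Ω → Ξ) (T : ℕ → Ω → ℕ) : ℕ → MeasurableSpace Ω
  | 0 => ⊥
  | i + 1 => history ξ T i

lemma history_mono (ξ : Ω → Ξ) (T : ℕ → Ω → ℕ) {i k : ℕ} (h : i ≤ k) :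
    history ξ T i ≤ history ξ T k :=
  sup_le le_sup_left (iSup₂_le fun j hj =>
    le_sup_of_le_right (le_iSup₂_of_le (f := fun j (_ : j ≤ k) => MeasurableSpace.comap (T j) ⊤)
      j (hj.trans h) le_rfl))

lemma past_le_history (ξ : Ω → Ξ) (T : ℕ → Ω → ℕ) : ∀ i, past ξ T i ≤ history ξ T i
  | 0 => bot_le
  | i + 1 => history_mono ξ T i.le_succ

lemma measurable_history (ξ : Ω → Ξ) (T : ℕ → Ω → ℕ) (i : ℕ) : Measurable[history ξ T i] (T i) :=
  Measurable.mono (comap_measurable (T i))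
    (le_sup_of_le_right (le_iSup₂_of_le i le_rfl le_rfl)) le_rfl

variable [MeasurableSpace Ω]

/-- The standing assumptions: a bounded penalty, i.i.d. transmission times of finite mean, and a
randomization device that is independent of them. -/
structure Channel (μ : Measure Ω) (ξ : Ω → Ξ) (T : ℕ → Ω → ℕ) (p : ℕ → ℝ) (M : ℝ) : Prop where
  bound : ∀ δ, |p δ| ≤ M
  meas : ∀ i, Measurable (T i)
  pos : ∀ i ω, 1 ≤ T i ω
  indep : iIndepFun T μ
  ident : ∀ i, IdentDistrib (T i) (T 0) μ μ
  mean : Integrable (fun ω => (T 0 ω : ℝ)) μ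
  device_meas : Measurable ξ
  device_indep : IndepFun ξ (fun ω i => T i ω) μ

variable {μ : Measure Ω} {ξ : Ω → Ξ} {T : ℕ → Ω → ℕ} {p : ℕ → ℝ} {M : ℝ}

namespace Channel

lemma history_le (C : Channel μ ξ T p M) (i : ℕ) : history ξ T i ≤ ‹MeasurableSpace Ω› :=
  sup_le C.device_meas.comap_le (iSup₂_le fun j _ => (C.meas j).comap_le)

lemma past_le (C : Channel μ ξ T p M) (i : ℕ) : past ξ T i ≤ ‹MeasurableSpace Ω› :=
  (past_le_history ξ T i).trans (C.history_le i)

lemma map_eq (C : Channel μ ξ T p M) (i : ℕ) : μ.map (T i) = μ.map (T 0) := (C.ident i).map_eq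

lemma integral_comp (C : Channel μ ξ T p M) (f : ℕ → ℝ) (i : ℕ) :
    ∫ ω, f (T i ω) ∂μ = ∫ j, f j ∂(μ.map (T 0)) := by
  rw [← C.map_eq i, integral_map (C.meas i).aemeasurable Measurable.of_discrete.aestronglyMeasurable]

lemma integrable_comp (C : Channel μ ξ T p M) {f : ℕ → ℝ} (i : ℕ) :
    Integrable (fun ω => f (T i ω)) μ ↔ Integrable f (μ.map (T 0)) := by
  rw [← C.map_eq i,
    integrable_map_measure Measurable.of_discrete.aestronglyMeasurable (C.meas i).aemeasurable]
  rfl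

lemma ae_comp (C : Channel μ ξ T p M) {P : ℕ → Prop} (i : ℕ) :
    (∀ᵐ ω ∂μ, P (T i ω)) ↔ ∀ᵐ j ∂(μ.map (T 0)), P j := by
  rw [← C.map_eq i, ae_map_iff (C.meas i).aemeasurable (MeasurableSet.of_discrete)]

lemma mean_law (C : Channel μ ξ T p M) : Integrable (fun j : ℕ => (j : ℝ)) (μ.map (T 0)) :=
  (C.integrable_comp 0).1 C.mean

lemma one_le_law (C : Channel μ ξ T p M) : ∀ᵐ j ∂(μ.map (T 0)), 1 ≤ j :=
  (C.ae_comp 0).1 (ae_of_all _ (C.pos 0))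

lemma integrable_delay (C : Channel μ ξ T p M) (i : ℕ) : Integrable (fun ω => (T i ω : ℝ)) μ :=
  (C.integrable_comp (f := fun j => (j : ℝ)) i).2 C.mean_law

variable [IsProbabilityMeasure μ]

lemma indep_history (C : Channel μ ξ T p M) (i : ℕ) :
    Indep (history ξ T i) (MeasurableSpace.comap (T (i + 1)) ⊤) μ := by
  set Y : Ω → (Finset.range (i + 1) → ℕ) := fun ω j => T j ω with hY
  have hYm : Measurable Y := measurable_pi_lambda _ fun j => C.meas j
  have hYT : IndepFun Y (T (i + 1)) μ := by
    have h := C.indep.indepFun_finset (Finset.range (i + 1)) {i + 1} (by simp) C.meas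
    exact h.comp measurable_id (measurable_pi_apply ⟨i + 1, by simp⟩)
  have hξ : IndepFun ξ (fun ω => (Y ω, T (i + 1) ω)) μ := by
    refine C.device_indep.comp (φ := id)
      (ψ := fun y : ℕ → ℕ => ((fun j : Finset.range (i + 1) => y j), y (i + 1)))
      measurable_id ?_
    exact (measurable_pi_lambda _ fun j => measurable_pi_apply _).prodMk (measurable_pi_apply _)
  have h := IndepFun.prodMk_indepFun C.device_meas hYm (C.meas (i + 1)) hξ hYT
  rw [IndepFun_iff_Indep] at h
  refine indep_of_indep_of_le_left h (sup_le ?_ (iSup₂_le fun j hj => ?_))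
  · exact (measurable_fst.comp (comap_measurable fun ω => (ξ ω, Y ω))).comap_le
  · exact ((measurable_pi_apply (⟨j, by simpa using Nat.lt_succ_of_le hj⟩ :
      Finset.range (i + 1))).comp
        (measurable_snd.comp (comap_measurable fun ω => (ξ ω, Y ω)))).comap_le

lemma indep_past (C : Channel μ ξ T p M) :
    ∀ i, Indep (past ξ T i) (MeasurableSpace.comap (T i) ⊤) μ
  | 0 => indep_bot_left _
  | i + 1 => C.indep_history i

lemma isProbabilityMeasure_law (C : Channel μ ξ T p M) : IsProbabilityMeasure (μ.map (T 0)) :=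
  Measure.isProbabilityMeasure_map (C.meas 0).aemeasurable

/-- The Gittins index in terms of the excess over a reference rate. -/
lemma le_gittins_iff (C : Channel μ ξ T p M) (β : ℝ) (δ : ℕ) :
    β ≤ gittins μ p T δ ↔ Ready (meanPenalty (μ.map (T 0)) p) β δ := by
  have := C.isProbabilityMeasure_law
  have hq : ∀ k, ∫ ω, p (δ + k + T 1 ω) ∂μ = meanPenalty (μ.map (T 0)) p (δ + k) := fun k =>
    C.integral_comp (fun j => p (δ + k + j)) 1
  have key : ∀ m : ℕ, β ≤ (1 / ((m + 1 : ℕ) : ℝ)) *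
      ∑ k ∈ Finset.range (m + 1), meanPenalty (μ.map (T 0)) p (δ + k) ↔
      0 ≤ excess (meanPenalty (μ.map (T 0)) p) β δ (m + 1) := fun m => by
    rw [one_div, inv_mul_eq_div, le_div_iff₀ (by positivity), excess_eq_sum_sub, sub_nonneg]
  unfold gittins
  simp_rw [hq]
  rw [le_ciInf_iff]
  · simp_rw [key]
    refine ⟨fun h m => ?_, fun h m => h (m + 1)⟩
    cases m with
    | zero => simp
    | succ m => exact h m
  · refine ⟨-M, ?_⟩
    rintro _ ⟨m, rfl⟩
    dsimp only
    have h1 := neg_le_of_abs_le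
      (abs_excess_le (abs_meanPenalty_le (ν := μ.map (T 0)) C.bound) 0 δ (m + 1))
    simp only [excess, sub_zero, abs_zero, add_zero] at h1
    rw [one_div, inv_mul_eq_div, le_div_iff₀ (by positivity)]
    linarith

end Channel

end Independence

end PathAndPast

section CycleMeans


variable {Ω : Type*} {Ξ : Type*} [MeasurableSpace Ω] [MeasurableSpace Ξ]
  {μ : Measure Ω} {ξ : Ω → Ξ} {T : ℕ → Ω → ℕ} {p : ℕ → ℝ} {M : ℝ}

/-! ### Mean excess in a cycle of a causal policy -/

omit [MeasurableSpace Ω] in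
lemma measurable_excess {m : MeasurableSpace Ω} (p : ℕ → ℝ) (β : ℝ) {x w : Ω → ℕ}
    (hx : Measurable[m] x) (hw : Measurable[m] w) :
    Measurable[m] fun ω => excess p β (x ω) (w ω) :=
  (Measurable.of_discrete (f := fun y : ℕ × ℕ => excess p β y.1 y.2)).comp (hx.prodMk hw)

namespace Channel

/-- Averaging the excess of a cycle over the transmission time that ends it. -/
lemma setIntegral_excess [IsProbabilityMeasure μ] (C : Channel μ ξ T p M) (β : ℝ) {i : ℕ}
    {x W : Ω → ℕ} {A : Set Ω} (hx : Measurable[history ξ T i] x)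
    (hW : Measurable[history ξ T i] W) (hA : MeasurableSet[history ξ T i] A)
    (hWint : Integrable (fun ω => (W ω : ℝ)) μ) :
    Integrable (fun ω => excess p β (x ω) (W ω + T (i + 1) ω)) μ ∧
    Integrable (fun ω => ∫ j, excess p β (x ω) (W ω + j) ∂(μ.map (T 0))) μ ∧
    ∫ ω in A, excess p β (x ω) (W ω + T (i + 1) ω) ∂μ =
      ∫ ω in A, ∫ j, excess p β (x ω) (W ω + j) ∂(μ.map (T 0)) ∂μ := by
  have hle := C.history_le i
  have hint : Integrable (fun ω => excess p β (x ω) (W ω + T (i + 1) ω)) μ := by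
    refine ((hWint.add (C.integrable_delay (i + 1))).const_mul (M + |β|)).mono'
      (measurable_excess p β (hx.mono hle le_rfl)
        ((hW.mono hle le_rfl).add (C.meas _))).aestronglyMeasurable (ae_of_all _ fun ω => ?_)
    simpa using abs_excess_le C.bound β (x ω) (W ω + T (i + 1) ω)
  have hA' : MeasurableSet A := hle _ hA
  have hm : ∀ j, Measurable[history ξ T i] fun ω => excess p β (x ω) (W ω + j) := fun j =>
    measurable_excess p β hx (hW.add_const j)
  have h1 := integral_apply_of_indep hle (C.meas (i + 1)) (C.indep_history i) hm hint
  have h2 := integral_apply_of_indep hle (C.meas (i + 1)) (C.indep_history i)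
    (f := fun ω j => A.indicator (fun ω => excess p β (x ω) (W ω + j)) ω)
    (fun j => (hm j).indicator hA) (hint.indicator hA')
  rw [C.map_eq] at h1 h2
  refine ⟨hint, h1.1, ?_⟩
  rw [← integral_indicator hA', ← integral_indicator hA']
  refine h2.2.trans (integral_congr_ae (ae_of_all _ fun ω => ?_))
  by_cases hω : ω ∈ A <;> simp [hω]

variable {F : Finset ℕ} {β : ℝ}

lemma integrable_comp_add (C : Channel μ ξ T p M) {f : ℕ → ℝ} {i : ℕ} {b : Ω → ℕ}
    (hb : Measurable b) (hbF : ∀ ω, b ω ∈ F) (hf : ∀ k ∈ F, Integrable (fun j => f (j + k)) (μ.map (T 0))) :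
    Integrable (fun ω => f (T i ω + b ω)) μ := by
  have hsum : Integrable (fun ω => ∑ k ∈ F, |f (T i ω + k)|) μ :=
    integrable_finsetSum _ fun k hk =>
      ((C.integrable_comp (f := fun j => f (j + k)) i).2 (hf k hk)).abs
  refine hsum.mono' ?_ (ae_of_all _ fun ω => ?_)
  · exact ((Measurable.of_discrete (f := fun y : ℕ × ℕ => f (y.1 + y.2))).comp
      ((C.meas i).prodMk hb)).aestronglyMeasurable
  · exact Finset.single_le_sum (f := fun k => |f (T i ω + k)|)
      (fun k _ => abs_nonneg _) (hbF ω)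

/-- Averaging the cycle value over the transmission time at whose end the cycle starts. -/
lemma setIntegral_cycleValue [IsProbabilityMeasure μ] (C : Channel μ ξ T p M)
    (hwp : ∀ k ∈ F, WellPosed (μ.map (T 0)) p β k) {i : ℕ} {b : Ω → ℕ} {A : Set Ω}
    (hb : Measurable[past ξ T i] b) (hbF : ∀ ω, b ω ∈ F) (hA : MeasurableSet[past ξ T i] A) :
    Integrable (fun ω => cycleValue (μ.map (T 0)) p β (T i ω + b ω)) μ ∧
    ∫ ω in A, cycleValue (μ.map (T 0)) p β (T i ω + b ω) ∂μ =
      ∫ ω in A, rootFun (μ.map (T 0)) p β (b ω) ∂μ := by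
  have := C.isProbabilityMeasure_law
  have hle := C.past_le i
  have hint : Integrable (fun ω => cycleValue (μ.map (T 0)) p β (T i ω + b ω)) μ :=
    C.integrable_comp_add (hb.mono hle le_rfl) hbF
      fun k hk => (hwp k hk).integrable_cycleValue C.bound C.mean_law
  have hA' : MeasurableSet A := hle _ hA
  refine ⟨hint, ?_⟩
  have hm : ∀ j : ℕ, Measurable[past ξ T i] fun ω => cycleValue (μ.map (T 0)) p β (j + b ω) :=
    fun j => (Measurable.of_discrete
      (f := fun k : ℕ => cycleValue (μ.map (T 0)) p β (j + k))).comp hb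
  have h2 := integral_apply_of_indep hle (C.meas i) (C.indep_past i)
    (f := fun ω j => A.indicator (fun ω => cycleValue (μ.map (T 0)) p β (j + b ω)) ω)
    (fun j => (hm j).indicator hA) (hint.indicator hA')
  rw [C.map_eq] at h2
  rw [← integral_indicator hA', ← integral_indicator hA']
  refine h2.2.trans (integral_congr_ae (ae_of_all _ fun ω => ?_))
  by_cases hω : ω ∈ A <;> simp [hω, rootFun]

lemma ae_exists_ready (C : Channel μ ξ T p M)
    (hwp : ∀ k ∈ F, WellPosed (μ.map (T 0)) p β k) (i : ℕ) {b : Ω → ℕ}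
    (hbF : ∀ ω, b ω ∈ F) :
    ∀ᵐ ω ∂μ, ∃ z, Ready (meanPenalty (μ.map (T 0)) p) β (T i ω + b ω + z) := by
  have h : ∀ᵐ ω ∂μ, ∀ k ∈ F, ∃ z, Ready (meanPenalty (μ.map (T 0)) p) β (T i ω + k + z) :=
    (Finset.eventually_all F).2 fun k hk => (C.ae_comp i).2 (hwp k hk).1
  exact h.mono fun ω hω => hω (b ω) (hbF ω)

/-- Whatever the waiting time, the mean excess of a cycle is at least the value of the root
function at the buffer position in use. -/
lemma setIntegral_rootFun_le [IsProbabilityMeasure μ] (C : Channel μ ξ T p M)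
    (hwp : ∀ k ∈ F, WellPosed (μ.map (T 0)) p β k) {i : ℕ} {b : Ω → ℕ} {W : Ω → ℕ}
    {A : Set Ω} (hb : Measurable[past ξ T i] b) (hbF : ∀ ω, b ω ∈ F) (hA : MeasurableSet[past ξ T i] A)
    (hW : Measurable[history ξ T i] W) (hWint : Integrable (fun ω => (W ω : ℝ)) μ) :
    ∫ ω in A, rootFun (μ.map (T 0)) p β (b ω) ∂μ ≤
      ∫ ω in A, excess p β (T i ω + b ω) (W ω + T (i + 1) ω) ∂μ := by
  have := C.isProbabilityMeasure_law
  have hx : Measurable[history ξ T i] fun ω => T i ω + b ω :=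
    (measurable_history ξ T i).add (hb.mono (past_le_history ξ T i) le_rfl)
  obtain ⟨-, h1, h2⟩ := C.setIntegral_excess β hx hW (past_le_history ξ T i _ hA) hWint
  obtain ⟨h3, h4⟩ := C.setIntegral_cycleValue hwp hb hbF hA
  rw [h2, ← h4]
  refine setIntegral_mono_ae h3.integrableOn h1.integrableOn ?_
  exact (C.ae_exists_ready hwp i hbF).mono fun ω hω => cycleValue_le C.bound C.mean_law hω _

lemma setIntegral_rootFun_eq [IsProbabilityMeasure μ] (C : Channel μ ξ T p M)
    (hwp : ∀ k ∈ F, WellPosed (μ.map (T 0)) p β k) {i : ℕ} {b : Ω → ℕ}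
    {A : Set Ω} (hb : Measurable[past ξ T i] b) (hbF : ∀ ω, b ω ∈ F) (hA : MeasurableSet[past ξ T i] A) :
    ∫ ω in A, excess p β (T i ω + b ω)
        (waitTime (meanPenalty (μ.map (T 0)) p) β (T i ω + b ω) + T (i + 1) ω) ∂μ =
      ∫ ω in A, rootFun (μ.map (T 0)) p β (b ω) ∂μ := by
  have hx : Measurable[history ξ T i] fun ω => T i ω + b ω :=
    (measurable_history ξ T i).add (hb.mono (past_le_history ξ T i) le_rfl)
  have hWint : Integrable
      (fun ω => (waitTime (meanPenalty (μ.map (T 0)) p) β (T i ω + b ω) : ℝ)) μ :=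
    C.integrable_comp_add (f := fun x => (waitTime (meanPenalty (μ.map (T 0)) p) β x : ℝ))
      (hb.mono (C.past_le i) le_rfl) hbF fun k hk => (hwp k hk).2
  obtain ⟨-, -, h2⟩ := C.setIntegral_excess β hx
    ((Measurable.of_discrete (f := waitTime (meanPenalty (μ.map (T 0)) p) β)).comp hx)
    (past_le_history ξ T i _ hA) hWint
  exact h2.trans (C.setIntegral_cycleValue hwp hb hbF hA).2

end Channel

/-! ### The average cost of a causal policy -/

namespace CausalPolicy

variable {B : ℕ} {b₀ : Fin B} (π : CausalPolicy ξ T B b₀)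

omit [MeasurableSpace Ω] in
lemma measurable_S_past : ∀ i, Measurable[past ξ T i] (π.S i)
  | 0 => by
    rw [show π.S 0 = fun _ => 0 from funext π.S_zero]
    exact measurable_const
  | i + 1 => (π.causal_S i).mono le_rfl le_top

omit [MeasurableSpace Ω] in
lemma measurable_b_past : ∀ i, Measurable[past ξ T i] (π.b i)
  | 0 => by
    rw [show π.b 0 = fun _ => b₀ from funext π.b_zero]
    exact measurable_const
  | i + 1 => (π.causal_b i).mono le_rfl le_top

omit [MeasurableSpace Ω] in
lemma measurable_position_past (i : ℕ) : Measurable[past ξ T i] fun ω => (π.b i ω : ℕ) :=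
  (Measurable.of_discrete (f := fun k : Fin B => (k : ℕ))).comp (π.measurable_b_past i)

omit [MeasurableSpace Ω] in
lemma measurableSet_submit_lt (i n : ℕ) : MeasurableSet[past ξ T i] {ω | π.S i ω < n} :=
  π.measurable_S_past i (MeasurableSet.of_discrete (s := Set.Iio (n : ℕ∞)))

omit [MeasurableSpace Ω] in
lemma measurable_delivery_history (i : ℕ) :
    Measurable[history ξ T i] (delivery π.S T i) :=
  (Measurable.of_discrete (f := fun y : ℕ∞ × ℕ => y.1 + (y.2 : ℕ∞))).comp
    (((π.measurable_S_past i).mono (past_le_history ξ T i) le_rfl).prodMk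
      (measurable_history ξ T i))

lemma measurable_age (C : Channel μ ξ T p M) (a₀ t : ℕ) : Measurable (π.age a₀ t) := by
  classical
  have hD : ∀ i, Measurable (delivery π.S T i) := fun i =>
    (π.measurable_delivery_history i).mono (C.history_le i) le_rfl
  have hset : ∀ i, MeasurableSet {ω | delivery π.S T i ω ≤ t} := fun i =>
    hD i (MeasurableSet.of_discrete (s := Set.Iic (t : ℕ∞)))
  refine Measurable.ite (hset 0) ?_ measurable_const
  have hG : ∀ i, Measurable fun ω => t - (π.S i ω).toNat + (π.b i ω : ℕ) := fun i =>
    (Measurable.of_discrete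
      (f := fun y : ℕ∞ × Fin B => t - y.1.toNat + (y.2 : ℕ))).comp
      (((π.measurable_S_past i).mono (C.past_le i) le_rfl).prodMk
        ((π.measurable_b_past i).mono (C.past_le i) le_rfl))
  have hG' : Measurable fun y : Ω × ℕ => t - (π.S y.2 y.1).toNat + (π.b y.2 y.1 : ℕ) :=
    measurable_from_prod_countable_left hG
  exact hG'.comp (measurable_id.prodMk (measurable_findGreatest fun k _ => hset k))

lemma integrable_penalty_age [IsFiniteMeasure μ] (C : Channel μ ξ T p M) (a₀ t : ℕ) :
    Integrable (fun ω => p (π.age a₀ t ω)) μ :=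
  Integrable.of_bound (Measurable.of_discrete.comp (π.measurable_age C a₀ t)).aestronglyMeasurable
    M (ae_of_all _ fun _ => C.bound _)

/-- The mean excess up to slot `n` differs from the mean excess over the cycles of the features
submitted before `n` by an overshoot. The overshoot is at most `2 K` plus the sum over all the
cycles of the parts above `K`, which is `o(n)` after `n → ∞` and then `K → ∞`. -/
lemma abs_integral_sub_sum_le [IsProbabilityMeasure μ] (C : Channel μ ξ T p M) (a₀ : ℕ) (β : ℝ)
    {n : ℕ} (hn : 0 < n) (K : ℕ) {W : ℕ → Ω → ℕ} {ρ : ℕ → ℕ}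
    (hρ : Integrable (fun j => (ρ j : ℝ)) (μ.map (T 0)))
    (hWm : ∀ i, Measurable[history ξ T i] (W i))
    (hWint : ∀ i, Integrable (fun ω => (W i ω : ℝ)) μ)
    (hW : ∀ᵐ ω ∂μ, ∀ i, π.S (i + 1) ω < n → delivery π.S T i ω + W i ω = π.S (i + 1) ω)
    (hW_le : ∀ᵐ ω ∂μ, ∀ i, π.S i ω < n → delivery π.S T i ω + W i ω ≤ π.S (i + 1) ω)
    (hW_ge : ∀ᵐ ω ∂μ, ∀ i, π.S i ω < n → n ≤ π.S (i + 1) ω →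
      n ≤ delivery π.S T i ω + W i ω)
    (hR : ∀ᵐ ω ∂μ, ∀ i, π.S i ω < n → n ≤ π.S (i + 1) ω →
      delivery π.S T i ω + W i ω + T (i + 1) ω ≤ n + (ρ (T i ω) + T (i + 1) ω : ℕ)) :
    |∫ ω, ∑ t ∈ Finset.range n, (p (π.age a₀ t ω) - β) ∂μ -
      ∑ i ∈ Finset.range n, ∫ ω in {ω | π.S i ω < n},
        excess p β (T i ω + π.b i ω) (W i ω + T (i + 1) ω) ∂μ| ≤
      (M + |β|) * (∫ j, (j : ℝ) ∂(μ.map (T 0)) + 2 * K +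
        n * (∫ j, ((ρ j - K : ℕ) : ℝ) ∂(μ.map (T 0)) +
          ∫ j, ((j - K : ℕ) : ℝ) ∂(μ.map (T 0)))) := by
  have hc : 0 ≤ M + |β| := add_nonneg ((abs_nonneg _).trans (C.bound 0)) (abs_nonneg _)
  have hA : ∀ i, MeasurableSet {ω | π.S i ω < n} := fun i =>
    C.past_le i _ (π.measurableSet_submit_lt i n)
  have hx : ∀ i, Measurable[history ξ T i] fun ω => T i ω + π.b i ω := fun i =>
    (measurable_history ξ T i).add
      ((π.measurable_position_past i).mono (past_le_history ξ T i) le_rfl)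
  have hX : ∀ i, Integrable (fun ω => excess p β (T i ω + π.b i ω) (W i ω + T (i + 1) ω)) μ :=
    fun i => (C.setIntegral_excess β (hx i) (hWm i) MeasurableSet.univ (hWint i)).1
  have hXA : ∀ i, Integrable ({ω | π.S i ω < n}.indicator
      fun ω => excess p β (T i ω + π.b i ω) (W i ω + T (i + 1) ω)) μ :=
    fun i => (hX i).indicator (hA i)
  have hsub : ∀ f : ℕ → ℕ, Integrable (fun j => (f j : ℝ)) (μ.map (T 0)) →
      Integrable (fun j => ((f j - K : ℕ) : ℝ)) (μ.map (T 0)) := fun f hf =>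
    hf.mono' Measurable.of_discrete.aestronglyMeasurable
      (ae_of_all _ fun j => by simp)
  have hρK := hsub ρ hρ
  have hK : Integrable (fun j : ℕ => ((j - K : ℕ) : ℝ)) (μ.map (T 0)) := hsub id C.mean_law
  have hg : ∀ i, Integrable
      (fun ω => ((ρ (T i ω) - K : ℕ) : ℝ) + ((T (i + 1) ω - K : ℕ) : ℝ)) μ := fun i =>
    ((C.integrable_comp i).2 hρK).add ((C.integrable_comp (i + 1)).2 hK)
  have hgs : Integrable (fun ω => ∑ i ∈ Finset.range n,
      (((ρ (T i ω) - K : ℕ) : ℝ) + ((T (i + 1) ω - K : ℕ) : ℝ))) μ :=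
    integrable_finsetSum _ fun i _ => hg i
  have h0 : Integrable (fun ω => (T 0 ω : ℝ) + 2 * K) μ :=
    (C.integrable_delay 0).add (integrable_const _)
  have hleft : Integrable (fun ω => ∑ t ∈ Finset.range n, (p (π.age a₀ t ω) - β)) μ :=
    integrable_finsetSum _ fun t _ => (π.integrable_penalty_age C a₀ t).sub (integrable_const _)
  have hbound : Integrable (fun ω => (M + |β|) * ((T 0 ω : ℝ) + 2 * K +
      ∑ i ∈ Finset.range n, (((ρ (T i ω) - K : ℕ) : ℝ) + ((T (i + 1) ω - K : ℕ) : ℝ)))) μ :=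
    (h0.add hgs).const_mul _
  have hpath : ∀ᵐ ω ∂μ, ‖∑ t ∈ Finset.range n, (p (π.age a₀ t ω) - β) -
      ∑ i ∈ Finset.range n, {ω | π.S i ω < n}.indicator
        (fun ω => excess p β (T i ω + π.b i ω) (W i ω + T (i + 1) ω)) ω‖ ≤
      (M + |β|) * ((T 0 ω : ℝ) + 2 * K +
      ∑ i ∈ Finset.range n, (((ρ (T i ω) - K : ℕ) : ℝ) + ((T (i + 1) ω - K : ℕ) : ℝ))) := by
    filter_upwards [hW, hW_le, hW_ge, hR] with ω h1 h2 h3 h4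
    obtain ⟨I, hI, h⟩ := abs_sum_age_sub_sum_excess_le (b := fun i ω => (π.b i ω : ℕ))
      (π.S_zero ω) (fun i => π.delivery_le i ω) (fun i => C.pos i ω) a₀ C.bound β hn
      (fun i => W i ω) (fun i => ρ (T i ω) + T (i + 1) ω) h1 h2 h3 h4
    refine (le_of_eq ?_).trans (h.trans ?_)
    · rw [Real.norm_eq_abs]
      congr 2
      refine Finset.sum_congr rfl fun i _ => ?_
      rw [Set.indicator_apply]
      rfl
    · refine mul_le_mul_of_nonneg_left ?_ hc
      have h5 := Finset.single_le_sum (f := fun i =>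
        (((ρ (T i ω) - K : ℕ) : ℝ) + ((T (i + 1) ω - K : ℕ) : ℝ)))
        (fun i _ => by positivity) (Finset.mem_range.2 hI)
      have h6 : ((ρ (T I ω) + T (I + 1) ω : ℕ) : ℝ) ≤
          2 * K + (((ρ (T I ω) - K : ℕ) : ℝ) + ((T (I + 1) ω - K : ℕ) : ℝ)) := by
        exact_mod_cast (by omega : ρ (T I ω) + T (I + 1) ω ≤
          2 * K + ((ρ (T I ω) - K) + (T (I + 1) ω - K)))
      linarith
  have hmean := norm_integral_le_of_norm_le hbound hpath
  rw [integral_sub hleft (integrable_finsetSum _ fun i _ => hXA i),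
    integral_finsetSum _ fun i _ => hXA i, Real.norm_eq_abs] at hmean
  simp_rw [integral_indicator (hA _)] at hmean
  refine hmean.trans_eq ?_
  rw [integral_const_mul, integral_add h0 hgs,
    integral_add (C.integrable_delay 0) (integrable_const _),
    integral_finsetSum _ fun i _ => hg i]
  have hterm : ∀ i, ∫ ω, (((ρ (T i ω) - K : ℕ) : ℝ) + ((T (i + 1) ω - K : ℕ) : ℝ)) ∂μ =
      ∫ j, ((ρ j - K : ℕ) : ℝ) ∂(μ.map (T 0)) + ∫ j, ((j - K : ℕ) : ℝ) ∂(μ.map (T 0)) :=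
    fun i => by
      rw [integral_add ((C.integrable_comp i).2 hρK) ((C.integrable_comp (i + 1)).2 hK),
        C.integral_comp (fun j => ((ρ j - K : ℕ) : ℝ)) i,
        C.integral_comp (fun j => ((j - K : ℕ) : ℝ)) (i + 1)]
  simp_rw [hterm]
  rw [C.integral_comp (fun j => (j : ℝ)) 0, Finset.sum_const, Finset.card_range, nsmul_eq_mul,
    integral_const, probReal_univ, one_smul]

end CausalPolicy

end CycleMeans

section AverageCost


variable {Ω : Type*} {Ξ : Type*} [MeasurableSpace Ω] [MeasurableSpace Ξ]
  {μ : Measure Ω} [IsProbabilityMeasure μ] {ξ : Ω → Ξ} {T : ℕ → Ω → ℕ} {p : ℕ → ℝ} {M : ℝ}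

/-- The mean part above `K` of an integrable variable tends to zero. -/
lemma tendsto_integral_tsub {ν : Measure ℕ} {ρ : ℕ → ℕ} (hρ : Integrable (fun j => (ρ j : ℝ)) ν) :
    Tendsto (fun K : ℕ => ∫ j, ((ρ j - K : ℕ) : ℝ) ∂ν) atTop (nhds 0) := by
  have h := tendsto_integral_of_dominated_convergence (μ := ν)
    (F := fun (K : ℕ) j => ((ρ j - K : ℕ) : ℝ)) (f := fun _ => (0 : ℝ)) (fun j => (ρ j : ℝ))
    (fun K => Measurable.of_discrete.aestronglyMeasurable) hρ
    (fun K => ae_of_all _ fun j => by simp)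
    (ae_of_all _ fun j => by
      refine tendsto_const_nhds.congr' ?_
      filter_upwards [eventually_ge_atTop (ρ j)] with K hK
      simp [Nat.sub_eq_zero_of_le hK])
  simpa using h

/-- The bound on the overshoot is `o(n)`. -/
lemma eventually_overshoot_le {e : ℕ → ℝ} (he : Tendsto e atTop (nhds 0)) (c : ℝ)
    (m C₀ : ℝ) {ε : ℝ} (hε : 0 < ε) :
    ∃ K : ℕ, ∀ᶠ n : ℕ in atTop, c * (m + 2 * K + n * e K) + C₀ ≤ ε * n := by
  have h1 : Tendsto (fun K => c * e K) atTop (nhds 0) := by simpa using he.const_mul c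
  obtain ⟨K, hK⟩ := (h1.eventually (gt_mem_nhds (half_pos hε))).exists
  refine ⟨K, ?_⟩
  have h2 := (tendsto_natCast_atTop_atTop (R := ℝ)).const_mul_atTop (half_pos hε)
  filter_upwards [h2.eventually_ge_atTop (c * (m + 2 * K) + C₀)] with n hn
  have h3 : c * e K * n ≤ ε / 2 * n := by gcongr
  nlinarith

namespace CausalPolicy

variable {B : ℕ} {b₀ : Fin B} (π : CausalPolicy ξ T B b₀)

lemma abs_average_le (C : Channel μ ξ T p M) (a₀ n : ℕ) :
    |(1 / (n : ℝ)) * ∫ ω, ∑ t ∈ Finset.range n, p (π.age a₀ t ω) ∂μ| ≤ M := by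
  rcases Nat.eq_zero_or_pos n with rfl | hn
  · simpa using (abs_nonneg _).trans (C.bound 0)
  have hn' : (0 : ℝ) < n := by exact_mod_cast hn
  have h := norm_integral_le_of_norm_le_const (μ := μ)
    (f := fun ω => ∑ t ∈ Finset.range n, p (π.age a₀ t ω)) (C := n * M)
    (ae_of_all _ fun ω => (Finset.abs_sum_le_sum_abs _ _).trans <|
      (Finset.sum_le_sum fun t _ => C.bound _).trans_eq (by simp))
  rw [probReal_univ, mul_one, Real.norm_eq_abs] at h
  rw [abs_mul, abs_of_nonneg (by positivity : 0 ≤ 1 / (n : ℝ)), one_div, inv_mul_eq_div,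
    div_le_iff₀ hn']
  linarith

lemma mul_average_sub (C : Channel μ ξ T p M) (a₀ : ℕ) (β : ℝ) {n : ℕ} (hn : 0 < n) :
    n * ((1 / (n : ℝ)) * ∫ ω, ∑ t ∈ Finset.range n, p (π.age a₀ t ω) ∂μ - β) =
      ∫ ω, ∑ t ∈ Finset.range n, (p (π.age a₀ t ω) - β) ∂μ := by
  have hn' : (n : ℝ) ≠ 0 := by exact_mod_cast hn.ne'
  simp_rw [Finset.sum_sub_distrib]
  rw [integral_sub (integrable_finsetSum _ fun t _ => π.integrable_penalty_age C a₀ t)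
    (integrable_const _)]
  simp only [Finset.sum_const, Finset.card_range, nsmul_eq_mul, integral_const, probReal_univ,
    one_smul]
  field_simp

lemma abs_setIntegral_rootFun_zero_le (β : ℝ) (A : Set Ω) (ν : Measure ℕ) :
    |∫ ω in A, rootFun ν p β (π.b 0 ω) ∂μ| ≤ |rootFun ν p β b₀| := by
  have h := norm_setIntegral_le_of_norm_le_const (μ := μ) (s := A)
    (f := fun ω => rootFun ν p β (π.b 0 ω)) (C := |rootFun ν p β b₀|) (measure_lt_top μ A)
    (fun ω _ => by rw [π.b_zero ω, Real.norm_eq_abs])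
  exact h.trans (mul_le_of_le_one_right (abs_nonneg _) measureReal_le_one)

variable {β : ℝ}

/-- Lower bound for every policy. The sequence of cycles is cut at the horizon `n` by
submitting a feature at slot `n`, or at the first delivery after it. The mean excess of each of
the cycles is nonnegative, except possibly that of the first one, and the overshoot is `o(n)`. -/
theorem le_avgCost (C : Channel μ ξ T p M) (a₀ : ℕ)
    (hwp : ∀ k : Fin B, WellPosed (μ.map (T 0)) p β k)
    (hroot : ∀ i ω, 0 ≤ rootFun (μ.map (T 0)) p β (π.b (i + 1) ω)) :
    β ≤ avgCost μ p a₀ π := by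
  refine le_of_forall_sub_le fun ε hε => ?_
  have he := (tendsto_integral_tsub C.mean_law).add (tendsto_integral_tsub C.mean_law)
  rw [add_zero] at he
  obtain ⟨K, hK⟩ := eventually_overshoot_le he (M + |β|) (∫ j, (j : ℝ) ∂(μ.map (T 0)))
    |rootFun (μ.map (T 0)) p β b₀| hε
  refine le_limsup_of_frequently_le (Eventually.frequently ?_)
    (isBoundedUnder_of ⟨M, fun n => le_of_abs_le (π.abs_average_le C a₀ n)⟩)
  filter_upwards [hK, eventually_gt_atTop 0] with n hKn hn
  have hn' : (0 : ℝ) < n := by exact_mod_cast hn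
  -- waiting times of the policy cut at the horizon; they are bounded, and finite if `S (i + 1) = ⊤`
  set W : ℕ → Ω → ℕ := fun i ω =>
    (min (π.S (i + 1) ω) (max n (delivery π.S T i ω)) - delivery π.S T i ω).toNat with hWdef
  have hW_eq : ∀ i ω, π.S i ω < n →
      delivery π.S T i ω + W i ω = min (π.S (i + 1) ω) (max n (delivery π.S T i ω)) := by
    intro i ω hi
    have hD : delivery π.S T i ω ≠ ⊤ :=
      WithTop.add_ne_top.2 ⟨hi.ne_top, ENat.natCast_ne_top _⟩
    have hmin : min (π.S (i + 1) ω) (max n (delivery π.S T i ω)) ≠ ⊤ :=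
      ((min_le_right _ _).trans_lt (max_lt (ENat.natCast_lt_top n) hD.lt_top)).ne
    rw [hWdef]
    dsimp only
    rw [ENat.natCast_toNat (ne_top_of_le_ne_top hmin tsub_le_self), add_tsub_cancel_of_le]
    exact le_min (π.delivery_le i ω) (le_max_right _ _)
  have hWm : ∀ i, Measurable[history ξ T i] (W i) := fun i =>
    (Measurable.of_discrete
      (f := fun y : ℕ∞ × ℕ∞ => (min y.1 (max n y.2) - y.2).toNat)).comp
      ((π.measurable_S_past (i + 1)).prodMk (π.measurable_delivery_history i))
  have hW_le_n : ∀ i ω, W i ω ≤ n := by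
    intro i ω
    refine ENat.toNat_le_of_le_natCast (tsub_le_iff_right.2 ((min_le_right _ _).trans ?_))
    exact max_le le_self_add le_add_self
  have hWint : ∀ i, Integrable (fun ω => (W i ω : ℝ)) μ := fun i =>
    Integrable.of_bound ((Measurable.of_discrete (f := fun k : ℕ => (k : ℝ))).comp
      ((hWm i).mono (C.history_le i) le_rfl)).aestronglyMeasurable n
      (ae_of_all _ fun ω => by simpa using hW_le_n i ω)
  have hover := π.abs_integral_sub_sum_le C a₀ β hn K (W := W) (ρ := id) C.mean_law hWm hWint
    (ae_of_all _ fun ω i hi => by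
      have hi' : π.S i ω < n := (submit_mono (fun i => π.delivery_le i ω) i.le_succ).trans_lt hi
      rw [hW_eq i ω hi']
      exact min_eq_left (hi.le.trans (le_max_left _ _)))
    (ae_of_all _ fun ω i hi => (hW_eq i ω hi).trans_le (min_le_left _ _))
    (ae_of_all _ fun ω i hi hi' => by
      rw [hW_eq i ω hi]
      exact le_min hi' (le_max_left _ _))
    (ae_of_all _ fun ω i hi _ => by
      rw [hW_eq i ω hi, Nat.cast_add, ← add_assoc]
      gcongr
      refine (min_le_right _ _).trans (max_le le_self_add ?_)
      rw [delivery]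
      gcongr
      rfl)
  have hsum : -|rootFun (μ.map (T 0)) p β b₀| ≤
      ∑ i ∈ Finset.range n, ∫ ω in {ω | π.S i ω < n},
        excess p β (T i ω + π.b i ω) (W i ω + T (i + 1) ω) ∂μ := by
    have h1 : ∀ i, ∫ ω in {ω | π.S i ω < n}, rootFun (μ.map (T 0)) p β (π.b i ω) ∂μ ≤
        ∫ ω in {ω | π.S i ω < n},
          excess p β (T i ω + π.b i ω) (W i ω + T (i + 1) ω) ∂μ := fun i =>
      C.setIntegral_rootFun_le (F := Finset.range B)
        (fun k hk => hwp ⟨k, Finset.mem_range.1 hk⟩) (π.measurable_position_past i)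
        (fun ω => Finset.mem_range.2 (π.b i ω).2) (π.measurableSet_submit_lt i n) (hWm i)
        (hWint i)
    refine le_trans ?_ (Finset.sum_le_sum fun i _ => h1 i)
    obtain ⟨m, rfl⟩ := Nat.exists_eq_succ_of_ne_zero hn.ne'
    rw [Finset.sum_range_succ']
    have h2 := neg_le_of_abs_le (π.abs_setIntegral_rootFun_zero_le (p := p) (μ := μ) β
      {ω | π.S 0 ω < (m + 1 : ℕ)} (μ.map (T 0)))
    have h3 : 0 ≤ ∑ i ∈ Finset.range m, ∫ ω in {ω | π.S (i + 1) ω < (m + 1 : ℕ)},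
        rootFun (μ.map (T 0)) p β (π.b (i + 1) ω) ∂μ :=
      Finset.sum_nonneg fun i _ => integral_nonneg fun ω => hroot i ω
    exact h2.trans (le_add_of_nonneg_left h3)
  rw [← π.mul_average_sub C a₀ β hn] at hover
  have h4 := neg_le_of_abs_le hover
  simp only [id] at h4
  have h5 : -ε * n ≤ n * ((1 / (n : ℝ)) * ∫ ω, ∑ t ∈ Finset.range n, p (π.age a₀ t ω) ∂μ - β) := by
    linarith
  rw [mul_comm] at h5
  have h6 := le_of_mul_le_mul_left h5 hn'
  linarith

/-- Upper bound for a policy that submits at the first ready age. -/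
theorem avgCost_le (C : Channel μ ξ T p M) (a₀ : ℕ)
    (hwp : ∀ k : Fin B, WellPosed (μ.map (T 0)) p β k)
    (hroot : ∀ i ω, rootFun (μ.map (T 0)) p β (π.b (i + 1) ω) ≤ 0)
    (hS : ∀ᵐ ω ∂μ, ∀ i, π.S (i + 1) ω = delivery π.S T i ω +
      waitTime (meanPenalty (μ.map (T 0)) p) β (T i ω + π.b i ω)) :
    avgCost μ p a₀ π ≤ β := by
  set w := waitTime (meanPenalty (μ.map (T 0)) p) β with hw
  set ρ : ℕ → ℕ := fun j => j + ∑ k : Fin B, w (j + k) with hρdef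
  have hρ : Integrable (fun j => (ρ j : ℝ)) (μ.map (T 0)) := by
    simp only [hρdef, Nat.cast_add, Nat.cast_sum]
    exact C.mean_law.add (integrable_finsetSum _ fun k _ => (hwp k).2)
  refine le_of_forall_pos_le_add fun ε hε => ?_
  have he := (tendsto_integral_tsub hρ).add (tendsto_integral_tsub C.mean_law)
  rw [add_zero] at he
  obtain ⟨K, hK⟩ := eventually_overshoot_le he (M + |β|) (∫ j, (j : ℝ) ∂(μ.map (T 0)))
    |rootFun (μ.map (T 0)) p β b₀| hε
  refine limsup_le_of_le (IsBoundedUnder.isCoboundedUnder_le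
    (isBoundedUnder_of ⟨-M, fun n => neg_le_of_abs_le (π.abs_average_le C a₀ n)⟩)) ?_
  filter_upwards [hK, eventually_gt_atTop 0] with n hKn hn
  have hn' : (0 : ℝ) < n := by exact_mod_cast hn
  set W : ℕ → Ω → ℕ := fun i ω => w (T i ω + π.b i ω) with hWdef
  have hWm : ∀ i, Measurable[history ξ T i] (W i) := fun i =>
    (Measurable.of_discrete (f := w)).comp ((measurable_history ξ T i).add
      ((π.measurable_position_past i).mono (past_le_history ξ T i) le_rfl))
  have hWint : ∀ i, Integrable (fun ω => (W i ω : ℝ)) μ := fun i =>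
    C.integrable_comp_add (F := Finset.range B) (f := fun x => (w x : ℝ))
      ((π.measurable_position_past i).mono (C.past_le i) le_rfl)
      (fun ω => Finset.mem_range.2 (π.b i ω).2)
      fun k hk => (hwp ⟨k, Finset.mem_range.1 hk⟩).2
  have hover := π.abs_integral_sub_sum_le C a₀ β hn K (W := W) (ρ := ρ) hρ hWm hWint
    (hS.mono fun ω h i _ => (h i).symm) (hS.mono fun ω h i _ => (h i).ge)
    (hS.mono fun ω h i _ hi' => hi'.trans (h i).le)
    (ae_of_all _ fun ω i hi _ => by
      have h1 : W i ω ≤ ∑ k : Fin B, w (T i ω + k) :=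
        Finset.single_le_sum (f := fun k : Fin B => w (T i ω + k)) (fun k _ => Nat.zero_le _)
          (Finset.mem_univ (π.b i ω))
      simp only [hρdef, delivery, Nat.cast_add, ← add_assoc]
      gcongr)
  have hsum : ∑ i ∈ Finset.range n, ∫ ω in {ω | π.S i ω < n},
        excess p β (T i ω + π.b i ω) (W i ω + T (i + 1) ω) ∂μ ≤
      |rootFun (μ.map (T 0)) p β b₀| := by
    have h1 : ∀ i, ∫ ω in {ω | π.S i ω < n},
          excess p β (T i ω + π.b i ω) (W i ω + T (i + 1) ω) ∂μ =
        ∫ ω in {ω | π.S i ω < n}, rootFun (μ.map (T 0)) p β (π.b i ω) ∂μ := fun i =>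
      C.setIntegral_rootFun_eq (F := Finset.range B)
        (fun k hk => hwp ⟨k, Finset.mem_range.1 hk⟩) (π.measurable_position_past i)
        (fun ω => Finset.mem_range.2 (π.b i ω).2) (π.measurableSet_submit_lt i n)
    rw [Finset.sum_congr rfl fun i _ => h1 i]
    obtain ⟨m, rfl⟩ := Nat.exists_eq_succ_of_ne_zero hn.ne'
    rw [Finset.sum_range_succ']
    have h2 := le_of_abs_le (π.abs_setIntegral_rootFun_zero_le (p := p) (μ := μ) β
      {ω | π.S 0 ω < (m + 1 : ℕ)} (μ.map (T 0)))
    have h3 : ∑ i ∈ Finset.range m, ∫ ω in {ω | π.S (i + 1) ω < (m + 1 : ℕ)},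
        rootFun (μ.map (T 0)) p β (π.b (i + 1) ω) ∂μ ≤ 0 :=
      Finset.sum_nonpos fun i _ => integral_nonpos fun ω => hroot i ω
    exact (add_le_of_nonpos_left h3).trans h2
  rw [← π.mul_average_sub C a₀ β hn] at hover
  have h4 := le_of_abs_le hover
  have h5 : n * ((1 / (n : ℝ)) * ∫ ω, ∑ t ∈ Finset.range n, p (π.age a₀ t ω) ∂μ - β) ≤ n * ε := by
    linarith
  have h6 := le_of_mul_le_mul_left h5 hn'
  linarith

end CausalPolicy

end AverageCost

section ThresholdRule


variable {Ω : Type*} {Ξ : Type*} [MeasurableSpace Ω] [MeasurableSpace Ξ]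

/-! ### The threshold rule -/

/-- The submission times of the Gittins-index threshold rule when feature `i` is taken from buffer
position `b i`. A sequence of positions is needed because the position of feature `0` is
prescribed and need not be the one used later. -/
def thresholdTimes (μ : Measure Ω) (p : ℕ → ℝ) (T : ℕ → Ω → ℕ) (b : ℕ → ℕ) (θ : ℝ) :
    ℕ → Ω → ℕ∞
  | 0, _ => 0
  | i + 1, ω =>
    sInf {s : ℕ∞ | ∃ t : ℕ, s = t ∧
      thresholdTimes μ p T b θ i ω + (T i ω : ℕ∞) ≤ t ∧
      θ ≤ gittins μ p T (t - (thresholdTimes μ p T b θ i ω).toNat + b i)}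

lemma thresholdSubmit_eq (μ : Measure Ω) (p : ℕ → ℝ) (T : ℕ → Ω → ℕ) (b : ℕ) (θ : ℝ) :
    thresholdSubmit μ p T b θ = thresholdTimes μ p T (fun _ => b) θ := by
  funext i
  induction i with
  | zero => rfl
  | succ i ih =>
    funext ω
    rw [thresholdSubmit, thresholdTimes, ih]

variable {μ : Measure Ω} {ξ : Ω → Ξ} {T : ℕ → Ω → ℕ} {p : ℕ → ℝ} {M : ℝ}
  {b : ℕ → ℕ} {θ : ℝ}

lemma delivery_le_thresholdTimes (i : ℕ) (ω : Ω) :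
    delivery (thresholdTimes μ p T b θ) T i ω ≤ thresholdTimes μ p T b θ (i + 1) ω := by
  rw [thresholdTimes]
  refine le_sInf ?_
  rintro _ ⟨t, rfl, h, -⟩
  exact h

lemma measurable_thresholdTimes (ξ : Ω → Ξ) :
    ∀ i, Measurable[past ξ T i] (thresholdTimes μ p T b θ i)
  | 0 => measurable_const
  | i + 1 => by
    have h := (Measurable.of_discrete (f := fun y : ℕ∞ × ℕ =>
      sInf {s : ℕ∞ | ∃ t : ℕ, s = t ∧ y.1 + (y.2 : ℕ∞) ≤ t ∧
        θ ≤ gittins μ p T (t - y.1.toNat + b i)})).comp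
      (((measurable_thresholdTimes ξ i).mono (past_le_history ξ T i) le_rfl).prodMk
        (measurable_history ξ T i))
    exact h

/-- The causal policy that follows the threshold rule `θ` and uses buffer position `k` for all
features but the first one. -/
def thresholdPolicy (μ : Measure Ω) (ξ : Ω → Ξ) (T : ℕ → Ω → ℕ) (p : ℕ → ℝ) {B : ℕ}
    (b₀ k : Fin B) (θ : ℝ) : CausalPolicy ξ T B b₀ where
  S := thresholdTimes μ p T (fun i => ((if i = 0 then b₀ else k : Fin B) : ℕ)) θ
  b i _ := if i = 0 then b₀ else k
  S_zero _ := rfl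
  b_zero _ := by simp
  delivery_le := delivery_le_thresholdTimes
  causal_S i := (measurable_thresholdTimes ξ (i + 1)).mono le_rfl (fun _ _ => .of_discrete)
  causal_b i := measurable_const

/-- The causal policy that sends nothing after the first feature. -/
def silentPolicy (ξ : Ω → Ξ) (T : ℕ → Ω → ℕ) {B : ℕ} (b₀ k : Fin B) :
    CausalPolicy ξ T B b₀ where
  S i _ := if i = 0 then 0 else ⊤
  b i _ := if i = 0 then b₀ else k
  S_zero _ := by simp
  b_zero _ := by simp
  delivery_le i ω := by simp
  causal_S i := measurable_const
  causal_b i := measurable_const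

/-- The threshold rule may be evaluated at the age of the policy that it defines, although the age
depends on the submission times: up to the submission, no other age matters. -/
lemma thresholdPolicy_S_succ (hT : ∀ i ω, 1 ≤ T i ω) {B : ℕ} (b₀ k : Fin B) (a₀ i : ℕ) (ω : Ω) :
    (thresholdPolicy μ ξ T p b₀ k θ).S (i + 1) ω =
      sInf {s : ℕ∞ | ∃ t : ℕ, s = t ∧
        delivery (thresholdPolicy μ ξ T p b₀ k θ).S T i ω ≤ t ∧
        θ ≤ gittins μ p T ((thresholdPolicy μ ξ T p b₀ k θ).age a₀ t ω)} := by
  set π := thresholdPolicy μ ξ T p b₀ k θ with hπ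
  have hdef : π.S (i + 1) ω = sInf {s : ℕ∞ | ∃ t : ℕ, s = t ∧ delivery π.S T i ω ≤ t ∧
      θ ≤ gittins μ p T (t - (π.S i ω).toNat + π.b i ω)} := by
    simp only [hπ, thresholdPolicy]
    rw [thresholdTimes]
    rfl
  have hage : ∀ t : ℕ, delivery π.S T i ω ≤ t → (t : ℕ∞) < delivery π.S T (i + 1) ω →
      π.age a₀ t ω = t - (π.S i ω).toNat + π.b i ω := fun t h h' =>
    age_eq (b := fun i ω => (π.b i ω : ℕ)) (fun i => π.delivery_le i ω) (fun i => hT i ω) a₀ h h'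
  refine le_antisymm (le_sInf ?_) ?_
  · rintro _ ⟨t, rfl, h1, h2⟩
    rcases lt_or_ge (t : ℕ∞) (delivery π.S T (i + 1) ω) with h | h
    · rw [hdef]
      exact sInf_le ⟨t, rfl, h1, by rwa [hage t h1 h] at h2⟩
    · exact le_self_add.trans h
  · by_cases htop : π.S (i + 1) ω = ⊤
    · rw [htop]
      exact le_top
    · have hne : {s : ℕ∞ | ∃ t : ℕ, s = t ∧ delivery π.S T i ω ≤ t ∧
          θ ≤ gittins μ p T (t - (π.S i ω).toNat + π.b i ω)}.Nonempty := by
        by_contra hemp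
        rw [Set.not_nonempty_iff_eq_empty] at hemp
        rw [hdef, hemp, sInf_empty] at htop
        exact htop rfl
      obtain ⟨t, ht, h1, h2⟩ := csInf_mem hne
      rw [← hdef] at ht
      have hlt : (t : ℕ∞) < delivery π.S T (i + 1) ω := by
        rw [delivery, ht]
        exact_mod_cast Nat.lt_add_of_pos_right (hT (i + 1) ω)
      exact sInf_le ⟨t, ht, h1, by rwa [hage t h1 hlt]⟩

omit [MeasurableSpace Ω] in
/-- Length and penalty of a cycle of the threshold rule. -/
lemma cycle_thresholdTimes {i : ℕ} {ω : Ω} {w : ℕ} {S : ℕ → Ω → ℕ∞} (hS : S i ω ≠ ⊤)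
    (hsucc : S (i + 1) ω = delivery S T i ω + w) (k : ℕ) :
    ((delivery S T (i + 1) ω).toNat : ℝ) - (delivery S T i ω).toNat =
      w + T (i + 1) ω ∧
    ∑ t ∈ Finset.Ico (delivery S T i ω).toNat (delivery S T (i + 1) ω).toNat,
      p (t - (S i ω).toNat + k) = excess p 0 (T i ω + k) (w + T (i + 1) ω) := by
  obtain ⟨s, hs⟩ := ENat.ne_top_iff_exists.1 hS
  have h0 : delivery S T i ω = ((s + T i ω : ℕ) : ℕ∞) := by simp [delivery, ← hs]
  have h1 : delivery S T (i + 1) ω = ((s + T i ω + (w + T (i + 1) ω) : ℕ) : ℕ∞) := by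
    rw [delivery, hsucc, h0]
    push_cast
    rw [add_assoc]
  rw [h0, h1, ← hs, ENat.toNat_natCast, ENat.toNat_natCast, ENat.toNat_natCast]
  refine ⟨by push_cast; ring, ?_⟩
  rw [Finset.sum_Ico_eq_sum_range, add_tsub_cancel_left, excess]
  refine Finset.sum_congr rfl fun j _ => ?_
  rw [sub_zero]
  congr 1
  omega

variable [IsProbabilityMeasure μ]

namespace Channel

lemma thresholdTimes_succ (C : Channel μ ξ T p M) {i : ℕ} {ω : Ω}
    (hS : thresholdTimes μ p T b θ i ω ≠ ⊤)
    (h : ∃ z, Ready (meanPenalty (μ.map (T 0)) p) θ (T i ω + b i + z)) :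
    thresholdTimes μ p T b θ (i + 1) ω = delivery (thresholdTimes μ p T b θ) T i ω +
      waitTime (meanPenalty (μ.map (T 0)) p) θ (T i ω + b i) := by
  obtain ⟨s, hs⟩ := ENat.ne_top_iff_exists.1 hS
  rw [thresholdTimes, delivery, ← hs]
  simp only [C.le_gittins_iff, ENat.toNat_natCast]
  apply le_antisymm
  · refine sInf_le ⟨s + T i ω + waitTime (meanPenalty (μ.map (T 0)) p) θ (T i ω + b i),
      by push_cast; rfl, by exact_mod_cast Nat.le_add_right _ _, ?_⟩
    convert ready_waitTime h using 1
    omega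
  · refine le_sInf ?_
    rintro _ ⟨t, rfl, h1, h2⟩
    have h1' : s + T i ω ≤ t := by exact_mod_cast h1
    obtain ⟨z, rfl⟩ := Nat.exists_eq_add_of_le h1'
    have h3 : waitTime (meanPenalty (μ.map (T 0)) p) θ (T i ω + b i) ≤ z := by
      refine waitTime_le ?_
      convert h2 using 1
      omega
    exact_mod_cast Nat.add_le_add_left h3 _

lemma exists_ready_of_thresholdTimes_one_ne_top (C : Channel μ ξ T p M) {ω : Ω}
    (h : thresholdTimes μ p T b θ 1 ω ≠ ⊤) :
    ∃ z, Ready (meanPenalty (μ.map (T 0)) p) θ (T 0 ω + b 0 + z) := by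
  by_contra hno
  push Not at hno
  refine h ?_
  rw [thresholdTimes, sInf_eq_top]
  rintro _ ⟨t, rfl, h1, h2⟩
  rw [C.le_gittins_iff] at h2
  have h1' : T 0 ω ≤ t := by simpa [thresholdTimes] using h1
  obtain ⟨z, rfl⟩ := Nat.exists_eq_add_of_le h1'
  refine absurd h2 ?_
  convert hno z using 2
  simp [thresholdTimes]
  omega

lemma ae_thresholdTimes_succ (C : Channel μ ξ T p M)
    (h : ∀ i, ∀ᵐ ω ∂μ, ∃ z, Ready (meanPenalty (μ.map (T 0)) p) θ (T i ω + b i + z)) :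
    ∀ᵐ ω ∂μ, ∀ i, thresholdTimes μ p T b θ i ω ≠ ⊤ ∧
      thresholdTimes μ p T b θ (i + 1) ω = delivery (thresholdTimes μ p T b θ) T i ω +
        waitTime (meanPenalty (μ.map (T 0)) p) θ (T i ω + b i) := by
  filter_upwards [ae_all_iff.2 h] with ω hω
  have hfin : ∀ i, thresholdTimes μ p T b θ i ω ≠ ⊤ := by
    intro i
    induction i with
    | zero => exact ENat.zero_ne_top
    | succ i ih =>
      rw [C.thresholdTimes_succ ih (hω i)]
      exact WithTop.add_ne_top.2 ⟨WithTop.add_ne_top.2 ⟨ih, ENat.natCast_ne_top _⟩,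
        ENat.natCast_ne_top _⟩
  exact fun i => ⟨hfin i, C.thresholdTimes_succ (hfin i) (hω i)⟩

/-! ### Roots -/

/-- The left-hand side of the equation that defines a root is the root function, in each cycle. -/
lemma integral_cycle_eq_rootFun (C : Channel μ ξ T p M) {k : ℕ} {β : ℝ}
    (hwp : WellPosed (μ.map (T 0)) p β k) (i : ℕ) :
    Integrable (fun ω => (waitTime (meanPenalty (μ.map (T 0)) p) β (T i ω + k) : ℝ) +
      T (i + 1) ω) μ ∧
    ∫ ω, excess p 0 (T i ω + k)
        (waitTime (meanPenalty (μ.map (T 0)) p) β (T i ω + k) + T (i + 1) ω) ∂μ -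
      β * ∫ ω, ((waitTime (meanPenalty (μ.map (T 0)) p) β (T i ω + k) : ℝ) + T (i + 1) ω) ∂μ =
    rootFun (μ.map (T 0)) p β k := by
  set w := waitTime (meanPenalty (μ.map (T 0)) p) β with hw
  have hx : Measurable[history ξ T i] fun ω => T i ω + k := (measurable_history ξ T i).add_const k
  have hWint : Integrable (fun ω => (w (T i ω + k) : ℝ)) μ :=
    (C.integrable_comp (f := fun j => (w (j + k) : ℝ)) i).2 hwp.2
  have hint : Integrable (fun ω => (w (T i ω + k) : ℝ) + T (i + 1) ω) μ :=
    hWint.add (C.integrable_delay _)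
  refine ⟨hint, ?_⟩
  have h1 : Integrable (fun ω => excess p 0 (T i ω + k) (w (T i ω + k) + T (i + 1) ω)) μ :=
    (C.setIntegral_excess 0 hx ((Measurable.of_discrete (f := w)).comp hx)
      MeasurableSet.univ hWint).1
  have h2 := C.setIntegral_rootFun_eq (F := {k}) (β := β) (b := fun _ => k) (i := i)
    (A := Set.univ) (by simpa using hwp) measurable_const (by simp) MeasurableSet.univ
  simp only [Measure.restrict_univ, integral_const, probReal_univ, one_smul] at h2
  rw [← h2, ← integral_const_mul, ← integral_sub h1 (hint.const_mul β)]
  refine integral_congr_ae (ae_of_all _ fun ω => ?_)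
  simp only [excess_eq_sum_sub]
  push_cast
  ring

theorem isRoot_iff (C : Channel μ ξ T p M) (k : ℕ) (β : ℝ) :
    IsRoot μ p T k β ↔ WellPosed (μ.map (T 0)) p β k ∧ rootFun (μ.map (T 0)) p β k = 0 := by
  unfold IsRoot
  rw [thresholdSubmit_eq]
  dsimp only
  set S := thresholdTimes μ p T (fun _ => k) β with hSdef
  constructor
  · intro h
    obtain ⟨hfin, hint, heq⟩ := h 0
    have hready : ∀ᵐ ω ∂μ, ∃ z, Ready (meanPenalty (μ.map (T 0)) p) β (T 0 ω + k + z) :=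
      hfin.mono fun ω hω => C.exists_ready_of_thresholdTimes_one_ne_top hω
    have hcyc : ∀ᵐ ω ∂μ, _ := hready.mono fun ω hω =>
      cycle_thresholdTimes (p := p) (S := S) (i := 0) (ω := ω) ENat.zero_ne_top
        (C.thresholdTimes_succ ENat.zero_ne_top hω) k
    have hwp : WellPosed (μ.map (T 0)) p β k := by
      refine ⟨(C.ae_comp 0).1 hready, (C.integrable_comp
        (f := fun j => (waitTime (meanPenalty (μ.map (T 0)) p) β (j + k) : ℝ)) 0).1 ?_⟩
      refine (hint.sub (C.integrable_delay 1)).congr (hcyc.mono fun ω hω => ?_)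
      simp only [Pi.sub_apply]
      rw [hω.1]
      simp
    refine ⟨hwp, ?_⟩
    refine (C.integral_cycle_eq_rootFun hwp 0).2.symm.trans (Eq.trans ?_ heq)
    rw [integral_congr_ae (hcyc.mono fun ω hω => hω.1),
      integral_congr_ae (hcyc.mono fun ω hω => hω.2)]
  · rintro ⟨hwp, h0⟩ i
    have hS := C.ae_thresholdTimes_succ (b := fun _ => k) (θ := β)
      fun i => (C.ae_comp i).2 hwp.1
    have hcyc : ∀ᵐ ω ∂μ, _ := hS.mono fun ω hω =>
      cycle_thresholdTimes (p := p) (S := S) (i := i) (ω := ω) (hω i).1 (hω i).2 k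
    obtain ⟨h1, h2⟩ := C.integral_cycle_eq_rootFun hwp i
    refine ⟨hS.mono fun ω hω => (hω (i + 1)).1, h1.congr (hcyc.mono fun ω hω => hω.1.symm), ?_⟩
    rw [integral_congr_ae (hcyc.mono fun ω hω => hω.1),
      integral_congr_ae (hcyc.mono fun ω hω => hω.2), h2, h0]

end Channel

end ThresholdRule

end FeatureBuffer

end

open FeatureBuffer in
theorem theorem4p2
    {Ω : Type*} [MeasurableSpace Ω] (μ : Measure Ω) [IsProbabilityMeasure μ]
    {Ξ : Type*} [MeasurableSpace Ξ] (ξ : Ω → Ξ) (T : ℕ → Ω → ℕ)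
    (B : ℕ) (b₀ : Fin B) (a₀ : ℕ) (p : ℕ → ℝ) (M : ℝ)
    (hp : ∀ δ, |p δ| ≤ M)
    (hT_meas : ∀ i, Measurable (T i))
    (hT_pos : ∀ i ω, 1 ≤ T i ω)
    (hT_indep : iIndepFun T μ)
    (hT_ident : ∀ i, IdentDistrib (T i) (T 0) μ μ)
    (hT_mean : Integrable (fun ω => (T 0 ω : ℝ)) μ)
    (hξ_meas : Measurable ξ)
    (hξ_indep : IndepFun ξ (fun ω i => T i ω) μ) :
    -- existence of the roots whenever transmitting is of use
    (∀ b : Fin B,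
      fixedOptValue μ p a₀ ξ T B b₀ b <
        liminf (fun n : ℕ => (1 / (n : ℝ)) * ∑ δ ∈ Finset.range n, p δ) atTop →
      ∃ β : ℝ, IsRoot μ p T b β) ∧
    -- uniqueness of the roots
    (∀ (b : Fin B) (β β' : ℝ), IsRoot μ p T b β → IsRoot μ p T b β' → β = β') ∧
    -- the optimal value and the optimal policy
    (∀ β : Fin B → ℝ, (∀ b : Fin B, IsRoot μ p T b (β b)) →
      IsLeast (Set.range β) (optValue μ p a₀ ξ T B b₀) ∧
      ∀ bstar : Fin B, (∀ b, β bstar ≤ β b) →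
        ∃ π : CausalPolicy ξ T B b₀,
          avgCost μ p a₀ π = optValue μ p a₀ ξ T B b₀ ∧
          (∀ π' : CausalPolicy ξ T B b₀, avgCost μ p a₀ π ≤ avgCost μ p a₀ π') ∧
          (∀ i ω, π.b (i + 1) ω = bstar) ∧
          (∀ i, ∀ᵐ ω ∂μ, π.S (i + 1) ω ≠ ⊤) ∧
          (∀ i ω, π.S (i + 1) ω =
            sInf {s : ℕ∞ | ∃ t : ℕ, s = t ∧ delivery π.S T i ω ≤ t ∧
              optValue μ p a₀ ξ T B b₀ ≤ gittins μ p T (π.age a₀ t ω)})) := by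
  have C : Channel μ ξ T p M :=
    ⟨hp, hT_meas, hT_pos, hT_indep, hT_ident, hT_mean, hξ_meas, hξ_indep⟩
  have hprob := C.isProbabilityMeasure_law
  refine ⟨fun b hb => ?_, fun b β β' h h' => ?_, fun β hβ => ?_⟩
  · obtain ⟨β₁, hβ₁, hβ₁'⟩ := exists_between hb
    have hwp : ∀ k : ℕ, WellPosed (μ.map (T 0)) p β₁ k :=
      wellPosed_of_lt_liminf hp C.mean_law hβ₁'
    have hle : rootFun (μ.map (T 0)) p β₁ b ≤ 0 := by
      by_contra hpos
      have hne : Nonempty {π : CausalPolicy ξ T B b₀ // ∀ i ω, π.b (i + 1) ω = b} :=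
        ⟨⟨silentPolicy ξ T b₀ b, fun i ω => rfl⟩⟩
      refine absurd hβ₁ (not_lt.2 (le_ciInf fun π => ?_))
      exact π.1.le_avgCost C a₀ (fun k => hwp k) fun i ω => by
        rw [π.2 i ω]
        exact (not_le.1 hpos).le
    obtain ⟨β, h1, h2⟩ := exists_root_of_rootFun_nonpos hp C.mean_law C.one_le_law (hwp b) hle
    exact ⟨β, (C.isRoot_iff b β).2 ⟨h1, h2⟩⟩
  · obtain ⟨h1, h2⟩ := (C.isRoot_iff b β).1 h
    obtain ⟨h1', h2'⟩ := (C.isRoot_iff b β').1 h'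
    exact root_unique hp C.mean_law C.one_le_law h1 h2 h1' h2'
  · have hroot := fun b : Fin B => (C.isRoot_iff b (β b)).1 (hβ b)
    -- a minimal root is a lower bound for every policy, and is attained by its threshold policy
    have key : ∀ bstar : Fin B, (∀ b, β bstar ≤ β b) →
        (∀ π : CausalPolicy ξ T B b₀, β bstar ≤ avgCost μ p a₀ π) ∧
        avgCost μ p a₀ (thresholdPolicy μ ξ T p b₀ bstar (β bstar)) ≤ β bstar ∧
        ∀ᵐ ω ∂μ, ∀ i, (thresholdPolicy μ ξ T p b₀ bstar (β bstar)).S i ω ≠ ⊤ := by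
      intro bstar hmin
      have hwp : ∀ k : Fin B, WellPosed (μ.map (T 0)) p (β bstar) k := fun k =>
        (hroot k).1.mono (hmin k)
      have hS := C.ae_thresholdTimes_succ (θ := β bstar)
        (b := fun i => ((if i = 0 then b₀ else bstar : Fin B) : ℕ))
        fun i => (C.ae_comp i).2 (hwp _).1
      refine ⟨fun π => π.le_avgCost C a₀ hwp fun i ω => ?_,
        CausalPolicy.avgCost_le _ C a₀ hwp (fun i ω => (hroot bstar).2.le)
          (hS.mono fun ω hω i => (hω i).2), hS.mono fun ω hω i => (hω i).1⟩
      rw [← (hroot (π.b (i + 1) ω)).2]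
      exact (hroot _).1.rootFun_antitone (hmin _) hp C.mean_law
    have hopt : ∀ bstar : Fin B, (∀ b, β bstar ≤ β b) →
        optValue μ p a₀ ξ T B b₀ = β bstar := by
      intro bstar hmin
      obtain ⟨h1, h2, -⟩ := key bstar hmin
      have hne : Nonempty (CausalPolicy ξ T B b₀) := ⟨silentPolicy ξ T b₀ b₀⟩
      exact le_antisymm ((ciInf_le ⟨β bstar, by rintro _ ⟨π, rfl⟩; exact h1 π⟩ _).trans h2)
        (le_ciInf h1)
    have hneB : Nonempty (Fin B) := ⟨b₀⟩
    refine ⟨?_, fun bstar hmin => ?_⟩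
    · obtain ⟨bstar, hmin⟩ := Finite.exists_min β
      rw [hopt bstar hmin]
      exact ⟨⟨bstar, rfl⟩, by rintro _ ⟨b, rfl⟩; exact hmin b⟩
    · obtain ⟨h1, h2, h3⟩ := key bstar hmin
      rw [hopt bstar hmin]
      exact ⟨thresholdPolicy μ ξ T p b₀ bstar (β bstar), le_antisymm h2 (h1 _),
        fun π' => h2.trans (h1 π'), fun i ω => rfl,
        fun i => h3.mono fun ω hω => hω (i + 1),
        fun i ω => thresholdPolicy_S_succ hT_pos b₀ bstar a₀ i ω⟩
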